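/- **Setting.** Let $d\ge 0$, $M,n\ge1$, and let $K\subset\mathbb R^d$ be a compact convex set with $\|x-y\|\le B$ for all $x,y\in K$, where $B>0$; let $x_1\in K$. Machine $i\in\{1,\dots,M\}$ has a sample space $\mathcal Z_i$ and losses $f_i(\cdot\,;z):K\to\mathbb R$, $z\in\mathcal Z_i$, which are differentiable, $G$-Lipschitz and $L$-smooth (i.e. $\|\nabla f_i(x;z)-\nabla f_i(y;z)\|\le L\|x-y\|$ on $K$), with $G,L>0$; in particular $\|\nabla f_i(x;z)\|\le G$ (if $K$ has empty interior, so that the gradient on $K$ is not unique, the gradients that are used are required to satisfy this). Machine $i$ holds a dataset $\mathcal S_i=(z_{1,i},\dots,z_{n,i})\in\mathcal Z_i^n$; the total number of samples is $|\mathcal S|=nM$. Let $\varepsilon>0$, $\delta\in(0,1)$, and put $$\rho=\sqrt{2(\varepsilon+\log(1/\delta))}-\sqrt{2\log(1/\delta)}\quad\Big(\text{so } \tfrac{\rho^2}{2}+\rho\sqrt{2\log(1/\delta)}=\varepsilon\Big),\qquad S=G+2LB .$$ **Algorithm** (Noisy-$\mu^2$-SGD, untrusted server, learning rate $\eta$).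 Let $\alpha_t=t$, $\beta_t=1/\alpha_t$, $\alpha_{1:t}=\sum_{\tau=1}^t\alpha_\tau$, $w_1=x_1$. In round $t=1,\dots,n$ every machine $i$ computes $d_{t,i}=\nabla f_i(x_t;z_{t,i})+(1-\beta_t)\big(d_{t-1,i}-\nabla f_i(x_{t-1};z_{t,i})\big)$ (so $d_{1,i}=\nabla f_i(x_1;z_{1,i})$) and $q_{t,i}=\alpha_t d_{t,i}$, and sends $q_{t,i}+Y_{t,i}$ to the server, where the $Y_{t,i}\sim\mathcal N(0,s^2I_d)$ are independent and $s=2S\sqrt n/\rho$. The server, with $\Pi_K$ the Euclidean projection, sets $$w_{t+1}=\Pi_K\Big(w_t-\tfrac{\eta}{M}\sum_{i=1}^M (q_{t,i}+Y_{t,i})\Big),\qquad x_{t+1}=\tfrac{\alpha_{1:t}}{\alpha_{1:t+1}}x_t+\tfrac{\alpha_{t+1}}{\alpha_{1:t+1}}w_{t+1}.$$ The output is $x_n$. **Theorem.** 1. *(Privacy.)* For every learning rate $\eta$ and every machine $i$, the sequence of all messages that the server receives during the $n$ rounds is $(\varepsilon,\delta)$-differentially private with respect to $\mathcal S_i$: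 for any two collections of datasets that differ only in one sample of $\mathcal S_i$, the message laws $P,P'$ satisfy $P(\mathcal O)\le e^{\varepsilon}P'(\mathcal O)+\delta$ for every measurable $\mathcal O$. No assumption on the distribution of the data and no convexity of the losses is needed here. 2. *(Computation.)* The run uses exactly $2nM=2|\mathcal S|$ gradient evaluations, and at most $14|\mathcal S|$ other elementary steps (additions and subtractions of vectors, multiplications of a vector by a scalar, draws of a noise vector, projections onto $K$), over all machines and the server. 3. *(Excess loss, heterogeneous machines.)* Let $\mathcal D_i$ be probability distributions on $\mathcal Z_i$, which may be different or equal, such that $f_i(\cdot\,;z)$ is convex for $\mathcal D_i$-almost every $z$, $f_i(x):=\mathbb E_{z\sim\mathcal D_i}f_i(x;z)$ is defined, and, for some $\sigma,\sigma_L\ge0$, all $i$, and all $x,y\in K$, with $\nabla f_i(x):=\mathbb E_{z\sim\mathcal D_i}\nabla f_i(x;z)$, $$\mathbb E\|\nabla f_i(x;z)-\nabla f_i(x)\|^2\le\sigma^2,\qquad \mathbb E\|(\nabla f_i(x;z)-\nabla f_i(x))-(\nabla f_i(y;z)-\nabla f_i(y))\|^2\le\sigma_L^2\|x-y\|^2 .$$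 Let all samples be independent, with $z_{t,i}\sim\mathcal D_i$, and independent of the noise. Put $f=\frac1M\sum_i f_i$, $\tilde\sigma=\sigma+2\sigma_LB$, and take $\eta=\rho B\sqrt M/(2Sn\sqrt d)$ (any value if $d=0$). Then $f(x_n)$ is integrable and $$\mathbb E f(x_n)-\min_{x\in K}f(x)\;\le\;4B\left(\frac{S}{n}+\frac{\tilde\sigma}{\sqrt{nM}}+\frac{S\sqrt d}{\rho\,n\sqrt M}\right).$$ Moreover, if $M\le n$ or $\varepsilon^2M\le d\,(\varepsilon+\log(1/\delta))$, then $$\mathbb E f(x_n)-\min_{x\in K}f(x)\;\le\;10B(S+\tilde\sigma)\left(\frac1{\sqrt{nM}}+\frac{\sqrt{d\,(\varepsilon+\log(1/\delta))}}{\varepsilon\,n\sqrt M}\right),$$ which is $O\big(\frac1{\sqrt{nM}}+\frac{\sqrt d}{\varepsilon n\sqrt M}\big)$ with a constant that depends only on $B,G,L,\sigma,\sigma_L$, on $\delta$ and on an upper bound for $\varepsilon$. The homogeneous case is the case of equal $\mathcal Z_i$, $f_i$, $\mathcal D_i$. -/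

import Mathlib

open MeasureTheory ProbabilityTheory
open scoped BigOperators

noncomputable section

namespace FedDP

/-- The ambient space `ℝ^d` with its Euclidean norm. -/
abbrev Vec (d : ℕ) : Type := EuclideanSpace ℝ (Fin d)

/-! ### Loss functions and sample distributions -/

/-- `f x z` is the loss of the point `x` on the sample `z`, and `g x z` is its gradient in `x`,
as a function on `K`. For every sample, `f` is `G`-Lipschitz and `L`-smooth on `K`. -/
structure IsSmoothLoss {d : ℕ} {Z : Type*} (K : Set (Vec d)) (f : Vec d → Z → ℝ)
    (g : Vec d → Z → Vec d) (G L : ℝ) : Prop where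
  hasGradient : ∀ z, ∀ x ∈ K, HasGradientWithinAt (fun y => f y z) (g x z) K x
  lipschitz : ∀ z, ∀ x ∈ K, ∀ y ∈ K, |f x z - f y z| ≤ G * ‖x - y‖
  smooth : ∀ z, ∀ x ∈ K, ∀ y ∈ K, ‖g x z - g y z‖ ≤ L * ‖x - y‖
  /-- If `K` has interior points, then this bound follows from the Lipschitz condition. If it has
  none, then the gradient along `K` is only determined up to a normal component, and the bound
  says that the chosen gradient is not longer than the Lipschitz constant. -/
  norm_grad_le : interior K = ∅ → ∀ z, ∀ x ∈ K, ‖g x z‖ ≤ G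

/-- The expected loss `x ↦ E_{z ∼ μ} f(x; z)` of one machine. -/
def expLoss {d : ℕ} {Z : Type*} [MeasurableSpace Z] (f : Vec d → Z → ℝ) (μ : Measure Z)
    (x : Vec d) : ℝ :=
  ∫ z, f x z ∂μ

/-- The gradient `x ↦ E_{z ∼ μ} ∇f(x; z)` of the expected loss of one machine. -/
def expGrad {d : ℕ} {Z : Type*} [MeasurableSpace Z] (g : Vec d → Z → Vec d) (μ : Measure Z)
    (x : Vec d) : Vec d :=
  ∫ z, g x z ∂μ

/-- The assumptions on the distribution `μ` of the samples of one machine: the expected loss is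
defined, the losses are convex, the gradients have variance at most `σ ^ 2`, and the smoothness
variance is at most `σL ^ 2`. -/
structure IsSampleLaw {d : ℕ} {Z : Type*} [MeasurableSpace Z] (K : Set (Vec d))
    (f : Vec d → Z → ℝ) (g : Vec d → Z → Vec d) (σ σL : ℝ) (μ : Measure Z) : Prop where
  integrable_loss : ∀ x ∈ K, Integrable (f x) μ
  measurable_grad : ∀ x ∈ K, Measurable (g x)
  convex : ∀ᵐ z ∂μ, ConvexOn ℝ K (fun x => f x z)
  variance_le : ∀ x ∈ K, ∫ z, ‖g x z - expGrad g μ x‖ ^ 2 ∂μ ≤ σ ^ 2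
  smoothness_variance_le : ∀ x ∈ K, ∀ y ∈ K,
    ∫ z, ‖(g x z - expGrad g μ x) - (g y z - expGrad g μ y)‖ ^ 2 ∂μ ≤ σL ^ 2 * ‖x - y‖ ^ 2

/-- The joint objective `f(x) = (1/M) ∑ i, E_{z ∼ D i} f_i(x; z)`. -/
def jointLoss {d M : ℕ} {Z : Fin M → Type*} [∀ i, MeasurableSpace (Z i)]
    (f : ∀ i, Vec d → Z i → ℝ) (D : ∀ i, Measure (Z i)) (x : Vec d) : ℝ :=
  (1 / (M : ℝ)) * ∑ i, expLoss (f i) (D i) x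

/-! ### Computations with a step count -/

/-- A computed value, together with the number `grads` of gradient evaluations and the number
`ops` of all other elementary steps that were spent on it. -/
structure Timed (α : Type*) where
  val : α
  grads : ℕ
  ops : ℕ

namespace Timed

def pure {α : Type*} (a : α) : Timed α := ⟨a, 0, 0⟩

def bind {α β : Type*} (c : Timed α) (k : α → Timed β) : Timed β :=
  ⟨(k c.val).val, c.grads + (k c.val).grads, c.ops + (k c.val).ops⟩

instance : Monad Timed where
  pure := Timed.pure
  bind := Timed.bind

/-- Run one computation on each of `M` machines; the total work of all machines is counted. -/
def onAll {M : ℕ} {α : Type*} (c : Fin M → Timed α) : Timed (Fin M → α) :=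
  ⟨fun i => (c i).val, ∑ i, (c i).grads, ∑ i, (c i).ops⟩

/-- One evaluation of a stochastic gradient at one sample. -/
def grad {d : ℕ} {Z : Type*} (g : Vec d → Z → Vec d) (x : Vec d) (z : Z) : Timed (Vec d) :=
  ⟨g x z, 1, 0⟩

/-- One vector addition. -/
def add {d : ℕ} (u v : Vec d) : Timed (Vec d) := ⟨u + v, 0, 1⟩

/-- One vector subtraction. -/
def sub {d : ℕ} (u v : Vec d) : Timed (Vec d) := ⟨u - v, 0, 1⟩

/-- One multiplication of a vector by a scalar. -/
def smul {d : ℕ} (c : ℝ) (v : Vec d) : Timed (Vec d) := ⟨c • v, 0, 1⟩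

/-- Drawing one noise vector. -/
def draw {d : ℕ} (Y : Vec d) : Timed (Vec d) := ⟨Y, 0, 1⟩

/-- The sum of `M` vectors, by `M` vector additions. -/
def sum {d M : ℕ} (v : Fin M → Vec d) : Timed (Vec d) := ⟨∑ i, v i, 0, M⟩

/-- The Euclidean projection of `x` onto `K`. -/
def projPoint {d : ℕ} (K : Set (Vec d)) (x : Vec d) : Vec d :=
  Classical.epsilon fun y => y ∈ K ∧ ∀ y' ∈ K, ‖x - y‖ ≤ ‖x - y'‖

/-- One projection onto `K`. -/
def proj {d : ℕ} (K : Set (Vec d)) (x : Vec d) : Timed (Vec d) := ⟨projPoint K x, 0, 1⟩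

end Timed

/-! ### The algorithm -/

/-- The importance weights `α_t = t`. -/
def impWeight (t : ℕ) : ℝ := t

/-- The corrected momentum weights `β_t = 1 / α_t`. -/
def momWeight (t : ℕ) : ℝ := 1 / impWeight t

/-- The sums `α_{1:t}`. -/
def impWeightSum (t : ℕ) : ℝ := ∑ τ ∈ Finset.Icc 1 t, impWeight τ

/-- What is stored before round `t`: the iterate `w = w_t`, the query point `x = x_t`, the previous
query point `xprev = x_{t-1}`, the corrected momenta `mom i = d_{t-1,i}` of the machines, and the
messages `msg i` that the machines sent to the server in round `t - 1`. -/
structure State (d M : ℕ) where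
  w : Vec d
  x : Vec d
  xprev : Vec d
  mom : Fin M → Vec d
  msg : Fin M → Vec d

/-- The initial state: `w_1 = x_1`. The values of `xprev` and `mom` do not matter, since
`1 - β_1 = 0`. -/
def initState {d : ℕ} (M : ℕ) (x₁ : Vec d) : State d M := ⟨x₁, x₁, x₁, fun _ => 0, fun _ => 0⟩

/-- The work of one machine in round `t`, on its sample `z` and its noise vector `Y`:
`d_t = ∇f(x_t; z) + (1 - β_t) (d_{t-1} - ∇f(x_{t-1}; z))`, `q_t = α_t d_t`. The result is `d_t` and
the message `q_t + Y`. -/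
def machineStep {d : ℕ} {Z : Type*} (g : Vec d → Z → Vec d) (t : ℕ) (x xprev mom : Vec d) (z : Z)
    (Y : Vec d) : Timed (Vec d × Vec d) := do
  let gt ← Timed.grad g x z
  let gprev ← Timed.grad g xprev z
  let diff ← Timed.sub mom gprev
  let corr ← Timed.smul (1 - momWeight t) diff
  let dt ← Timed.add gt corr
  let q ← Timed.smul (impWeight t) dt
  let noise ← Timed.draw Y
  let m ← Timed.add q noise
  return (dt, m)

/-- Round `t` of the algorithm, on the samples `z i = z_{t,i}` and the noise vectors
`Y i = Y_{t,i}`. The server averages the messages, makes the step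
`w_{t+1} = Π_K (w_t - η (1/M) ∑ i, msg i)`, and forms the next query point
`x_{t+1} = (α_{1:t} / α_{1:t+1}) x_t + (α_{t+1} / α_{1:t+1}) w_{t+1}`. -/
def round {d M : ℕ} {Z : Fin M → Type*} (K : Set (Vec d)) (g : ∀ i, Vec d → Z i → Vec d) (η : ℝ)
    (t : ℕ) (z : ∀ i, Z i) (Y : Fin M → Vec d) (s : State d M) : Timed (State d M) := do
  let r ← Timed.onAll fun i => machineStep (g i) t s.x s.xprev (s.mom i) (z i) (Y i)
  let total ← Timed.sum fun i => (r i).2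
  let avg ← Timed.smul (1 / (M : ℝ)) total
  let step ← Timed.smul η avg
  let moved ← Timed.sub s.w step
  let w' ← Timed.proj K moved
  let a ← Timed.smul (impWeightSum t / impWeightSum (t + 1)) s.x
  let b ← Timed.smul (impWeight (t + 1) / impWeightSum (t + 1)) w'
  let x' ← Timed.add a b
  return ⟨w', x', s.x, fun i => (r i).1, fun i => (r i).2⟩

/-- The datasets of all machines: `S i t` is the sample that machine `i` uses in round `t + 1`. -/
abbrev Datasets {M : ℕ} (Z : Fin M → Type*) (n : ℕ) : Type _ := ∀ i, Fin n → Z i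

/-- The noise of the whole run: `Y t i` is the noise vector of machine `i` in round `t + 1`. -/
abbrev Noise (d M n : ℕ) : Type := Fin n → Fin M → Vec d

/-- The first `t` rounds of the algorithm. -/
def run {d M n : ℕ} {Z : Fin M → Type*} (K : Set (Vec d)) (g : ∀ i, Vec d → Z i → Vec d) (η : ℝ)
    (x₁ : Vec d) (S : Datasets Z n) (Y : Noise d M n) : (t : ℕ) → t ≤ n → Timed (State d M)
  | 0, _ => Timed.pure (initState M x₁)
  | t + 1, h => Timed.bind (run K g η x₁ S Y t (Nat.le_of_succ_le h))
      (round K g η (t + 1) (fun i => S i ⟨t, h⟩) (Y ⟨t, h⟩))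

/-- The full run, of `n` rounds. -/
def fullRun {d M n : ℕ} {Z : Fin M → Type*} (K : Set (Vec d)) (g : ∀ i, Vec d → Z i → Vec d)
    (η : ℝ) (x₁ : Vec d) (S : Datasets Z n) (Y : Noise d M n) : Timed (State d M) :=
  run K g η x₁ S Y n le_rfl

/-- The output `x_n`, which is the query point of the last round. -/
def output {d M n : ℕ} {Z : Fin M → Type*} (K : Set (Vec d)) (g : ∀ i, Vec d → Z i → Vec d)
    (η : ℝ) (x₁ : Vec d) (S : Datasets Z n) (Y : Noise d M n) : Vec d :=
  (fullRun K g η x₁ S Y).val.xprev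

/-- The messages that the server receives in all rounds: `transcript … t i` is what machine `i`
sends in round `t + 1`. -/
def transcript {d M n : ℕ} {Z : Fin M → Type*} (K : Set (Vec d)) (g : ∀ i, Vec d → Z i → Vec d)
    (η : ℝ) (x₁ : Vec d) (S : Datasets Z n) (Y : Noise d M n) : Fin n → Fin M → Vec d :=
  fun t => (run K g η x₁ S Y (t + 1) t.isLt).val.msg

/-! ### Randomness -/

/-- The law of independent noise vectors, each with law `N(0, s ^ 2 I)`. -/
def noiseLaw (d M n : ℕ) (s : ℝ) : Measure (Noise d M n) :=
  Measure.pi fun _ => Measure.pi fun _ => (stdGaussian (Vec d)).map fun v => s • v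

/-- The law of the datasets: all samples are independent, and those of machine `i` have
law `D i`. -/
def dataLaw {M : ℕ} {Z : Fin M → Type*} [∀ i, MeasurableSpace (Z i)] (n : ℕ)
    (D : ∀ i, Measure (Z i)) : Measure (Datasets Z n) :=
  Measure.pi fun i => Measure.pi fun _ => D i

/-! ### Differential privacy -/

/-- `A S ω` is the outcome of a randomized algorithm on the data `S`, with random bits `ω` of
law `P`. It is `(ε, δ)`-differentially private for the neighbouring relation `nbr`. -/
def IsDP {𝒮 Ω Out : Type*} [MeasurableSpace Ω] [MeasurableSpace Out] (nbr : 𝒮 → 𝒮 → Prop)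
    (P : Measure Ω) (A : 𝒮 → Ω → Out) (ε δ : ℝ) : Prop :=
  ∀ S S', nbr S S' → ∀ O : Set Out, MeasurableSet O →
    P {ω | A S ω ∈ O} ≤ ENNReal.ofReal (Real.exp ε) * P {ω | A S' ω ∈ O} + ENNReal.ofReal δ

/-- `S` and `S'` differ at most in a single sample of machine `i`. -/
def NeighboursAt {M n : ℕ} {Z : Fin M → Type*} (i : Fin M) (S S' : Datasets Z n) : Prop :=
  (∀ j, j ≠ i → S j = S' j) ∧ ∃ t, ∀ s, s ≠ t → S i s = S' i s

/-! ### Parameters -/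

/-- The positive solution `ρ` of `ρ ^ 2 / 2 + ρ * √(2 log (1 / δ)) = ε`. -/
def budget (ε δ : ℝ) : ℝ :=
  √(2 * (ε + Real.log (1 / δ))) - √(2 * Real.log (1 / δ))

/-- The sensitivity `S = G + 2 L B`, where `B` is the bound on the diameter. -/
def sens (G L B : ℝ) : ℝ := G + 2 * L * B

/-- `σ + 2 σL B`. -/
def totalDev (σ σL B : ℝ) : ℝ := σ + 2 * σL * B

/-- The standard deviation `2 S √n / ρ` of the noise. -/
def noiseStd (G L B ε δ : ℝ) (n : ℕ) : ℝ := 2 * sens G L B * √n / budget ε δ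

/-- The learning rate `ρ B √M / (2 S n √d)`. -/
def learningRate (G L B ε δ : ℝ) (d M n : ℕ) : ℝ :=
  budget ε δ * B * √M / (2 * sens G L B * n * √d)

end FedDP

end

open MeasureTheory ProbabilityTheory
open scoped BigOperators

noncomputable section

namespace FedDP


/-! Everything rests on one identity. Since `α_{t+1} (1 - β_{t+1}) = t = α_t`, the weighted momentum
`q_t = α_t d_t` is a running sum: each round adds `∇f(x_t; z) + (t - 1) (∇f(x_t; z) - ∇f(x_{t-1};
z))`, and each sample enters exactly one summand (`impWeight_smul_mom`). The averaging moves the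
query point so slowly that `(t - 1) ‖x_t - x_{t-1}‖ ≤ 2B` (`norm_x_sub_xprev_le`), so a summand has
norm at most `S = G + 2LB` and, once centred, standard deviation at most `σ + 2 σL B`.

Privacy. Replacing one sample changes one summand, by at most `2S`. If this change is added to the
noise of the machine from that round on, all messages stay the same (`stateAt_noiseShift`). The
shift depends only on noise of earlier rounds, so the log density ratios of the rounds add up along
the run, and so do the bounds `lam (lam + 1) / 2 * (‖v‖ / s) ^ 2` on their log exponential moments.
A Chernoff bound (`measure_adapted_shift_le`) with total squared relative shift `ρ ^ 2` gives `(ε,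
δ)`.

Excess loss. The expectations of the summands telescope to `α_t ∇f_i(x_t)`, so the averaged message
is `α_t ∇f(x_t)` plus an error plus noise (`average_msg`). The error is an average over the machines
of martingale differences, of mean norm at most `(σ + 2 σL B) √(n / M)`; the noise has second moment
at most `d s ^ 2 / M`. The potential `α_{1:t} (f(x_t) - f(y)) + ‖w_t - y‖ ^ 2 / (2η)` grows in one
round only by a constant and these terms (`round_progress`), while `α_{1:n}` is of order `n ^ 2`.
Conditioning on the past is expressed by resampling a single coordinate of the product law
(`integral_le_of_resample`). -/

/-! ### Change of variables for adapted shifts of product measures -/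

/-- `ℓ v y` is the logarithmic density at `y` of the law `μ` relative to its translate by `v`, and
`q v` bounds the logarithm of its exponential moment of order `lam`. -/
structure IsShiftCost {E : Type*} [MeasurableSpace E] [Add E] (μ : Measure E) (lam : ℝ)
    (ℓ : E → E → ℝ) (q : E → ℝ) : Prop where
  measurable : Measurable (Function.uncurry ℓ)
  lintegral_shift : ∀ v (h : E → ENNReal), Measurable h →
    ∫⁻ y, h (y + v) * ENNReal.ofReal (Real.exp (-ℓ v y)) ∂μ = ∫⁻ y, h y ∂μ
  lintegral_exp_le : ∀ v,
    ∫⁻ y, ENNReal.ofReal (Real.exp (lam * ℓ v y)) ∂μ ≤ ENNReal.ofReal (Real.exp (q v))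

lemma measurable_cons {E : Type*} [MeasurableSpace E] {n : ℕ} :
    Measurable fun p : E × (Fin n → E) => (Fin.cons p.1 p.2 : Fin (n + 1) → E) := by
  refine measurable_pi_lambda _ fun t => ?_
  refine Fin.cases ?_ (fun t => ?_) t
  · simpa using measurable_fst
  · simp only [Fin.cons_succ]; fun_prop

lemma lintegral_pi_succ {E : Type*} [MeasurableSpace E] (μ : Measure E) [IsProbabilityMeasure μ]
    {n : ℕ} (f : (Fin (n + 1) → E) → ENNReal) (hf : Measurable f) :
    ∫⁻ y, f y ∂(Measure.pi fun _ => μ) =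
      ∫⁻ a, ∫⁻ b, f (Fin.cons a b) ∂(Measure.pi fun _ : Fin n => μ) ∂μ := by
  have h := (measurePreserving_piFinSuccAbove (fun _ : Fin (n + 1) => μ) 0).symm
  rw [← h.lintegral_comp hf, lintegral_prod]
  · simp [MeasurableEquiv.piFinSuccAbove, Fin.insertNthEquiv]
  · exact (hf.comp h.measurable).aemeasurable

namespace IsShiftCost

variable {E : Type*} [MeasurableSpace E] [AddGroup E] {μ : Measure E} {lam : ℝ} {ℓ : E → E → ℝ}
  {q : E → ℝ}

/-- The map `y ↦ y + v y` is triangular, so the one-coordinate densities multiply. The induction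
peels off coordinate `0`; once its value is fixed, the remaining shifts are again adapted. -/
theorem lintegral_adapted_shift [MeasurableAdd₂ E] [IsProbabilityMeasure μ]
    (H : IsShiftCost μ lam ℓ q) : ∀ {n : ℕ}
    (v : Fin n → (Fin n → E) → E), (∀ t, Measurable (v t)) →
    (∀ t y y', (∀ s < t, y s = y' s) → v t y = v t y') →
    ∀ h : (Fin n → E) → ENNReal, Measurable h →
    ∫⁻ y, h (fun t => y t + v t y) * ENNReal.ofReal (Real.exp (-∑ t, ℓ (v t y) (y t)))
      ∂(Measure.pi fun _ => μ) = ∫⁻ y, h y ∂(Measure.pi fun _ => μ)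
  | 0, v, hv, had, h, hh => by
      refine lintegral_congr fun y => ?_
      have : (fun t => y t + v t y) = y := Subsingleton.elim _ _
      simp [this]
  | n + 1, v, hv, had, h, hh => by
      have hsum : Measurable fun y : Fin (n + 1) → E => ∑ t, ℓ (v t y) (y t) :=
        Finset.measurable_sum _ fun t _ =>
          H.measurable.comp ((hv t).prodMk (measurable_pi_apply t))
      have hΦ : Measurable fun (y : Fin (n + 1) → E) t => y t + v t y :=
        measurable_pi_lambda _ fun t => (measurable_pi_apply t).add (hv t)
      have hint : Measurable fun y => h (fun t => y t + v t y) *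
          ENNReal.ofReal (Real.exp (-∑ t, ℓ (v t y) (y t))) :=
        (hh.comp hΦ).mul hsum.neg.exp.ennreal_ofReal
      rw [lintegral_pi_succ μ _ hint, lintegral_pi_succ μ _ hh]
      -- Nothing precedes coordinate `0`, so its shift is a constant and the one-coordinate formula
      -- applies.
      have h0 : ∀ y, v 0 y = v 0 0 := fun y => had 0 _ _ fun s hs => absurd hs (Fin.not_lt_zero s)
      have hH : Measurable fun a => ∫⁻ b, h (Fin.cons a b) ∂(Measure.pi fun _ : Fin n => μ) :=
        (hh.comp measurable_cons).lintegral_prod_right'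
      rw [← H.lintegral_shift (v 0 0) _ hH]
      refine lintegral_congr fun a => ?_
      have hc : Measurable fun b : Fin n → E => (Fin.cons a b : Fin (n + 1) → E) :=
        measurable_cons.comp measurable_prodMk_left
      have IH := H.lintegral_adapted_shift (fun t b => v t.succ (Fin.cons a b))
        (fun t => (hv t.succ).comp hc)
        (fun t b b' hb => had _ _ _ fun s hs => by
          refine Fin.cases (fun _ => rfl) (fun s hs => ?_) s hs
          simpa using hb s (Fin.succ_lt_succ_iff.1 hs))
        (fun b => h (Fin.cons (a + v 0 0) b))
        (hh.comp (measurable_cons.comp measurable_prodMk_left))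
      rw [← IH, ← lintegral_mul_const']
      · refine lintegral_congr fun b => ?_
        rw [Fin.sum_univ_succ, neg_add, Real.exp_add, ENNReal.ofReal_mul (Real.exp_pos _).le]
        have : (fun t => (Fin.cons a b : Fin (n + 1) → E) t + v t (Fin.cons a b)) =
            Fin.cons (a + v 0 0) (fun t => b t + v t.succ (Fin.cons a b)) := by
          funext t
          refine Fin.cases ?_ (fun t => ?_) t
          · simp [h0]
          · simp
        rw [this, h0 (Fin.cons a b)]
        simp only [Fin.cons_zero, Fin.cons_succ]
        ring
      · exact ENNReal.ofReal_ne_top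

/-- With coordinate `0` fixed, the inductive bound on the remaining coordinates is uniform in its
value. It therefore comes out of the integral as a constant factor. -/
theorem lintegral_exp_adapted_le [IsProbabilityMeasure μ] (H : IsShiftCost μ lam ℓ q) : ∀ {n : ℕ}
    (v : Fin n → (Fin n → E) → E), (∀ t, Measurable (v t)) →
    (∀ t y y', (∀ s < t, y s = y' s) → v t y = v t y') →
    ∀ c : Fin n → ℝ, (∀ t y, q (v t y) ≤ c t) →
    ∫⁻ y, ENNReal.ofReal (Real.exp (lam * ∑ t, ℓ (v t y) (y t))) ∂(Measure.pi fun _ => μ) ≤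
      ENNReal.ofReal (Real.exp (∑ t, c t))
  | 0, v, hv, had, c, hc => by simp
  | n + 1, v, hv, had, c, hc => by
      have hsum : Measurable fun y : Fin (n + 1) → E => ∑ t, ℓ (v t y) (y t) :=
        Finset.measurable_sum _ fun t _ =>
          H.measurable.comp ((hv t).prodMk (measurable_pi_apply t))
      rw [lintegral_pi_succ μ _ (hsum.const_mul lam).exp.ennreal_ofReal]
      have h0 : ∀ y, v 0 y = v 0 0 := fun y => had 0 _ _ fun s hs => absurd hs (Fin.not_lt_zero s)
      have hin : ∀ a, ∫⁻ b, ENNReal.ofReal (Real.exp (lam * ∑ t, ℓ (v t (Fin.cons a b))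
          ((Fin.cons a b : Fin (n + 1) → E) t))) ∂(Measure.pi fun _ : Fin n => μ) ≤
          ENNReal.ofReal (Real.exp (lam * ℓ (v 0 0) a)) *
            ENNReal.ofReal (Real.exp (∑ t : Fin n, c t.succ)) := by
        intro a
        have hcm : Measurable fun b : Fin n → E => (Fin.cons a b : Fin (n + 1) → E) :=
          measurable_cons.comp measurable_prodMk_left
        have IH := H.lintegral_exp_adapted_le (fun t b => v t.succ (Fin.cons a b))
          (fun t => (hv t.succ).comp hcm)
          (fun t b b' hb => had _ _ _ fun s hs => by
            refine Fin.cases (fun _ => rfl) (fun s hs => ?_) s hs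
            simpa using hb s (Fin.succ_lt_succ_iff.1 hs))
          (fun t => c t.succ) (fun t b => hc _ _)
        refine le_trans (le_of_eq ?_) (mul_le_mul_right IH _)
        rw [← lintegral_const_mul' _ _ ENNReal.ofReal_ne_top]
        refine lintegral_congr fun b => ?_
        rw [Fin.sum_univ_succ, mul_add, Real.exp_add, ENNReal.ofReal_mul (Real.exp_pos _).le, h0]
        simp only [Fin.cons_zero, Fin.cons_succ]
      refine (lintegral_mono hin).trans ?_
      rw [lintegral_mul_const' _ _ ENNReal.ofReal_ne_top, Fin.sum_univ_succ, Real.exp_add,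
        ENNReal.ofReal_mul (Real.exp_pos _).le]
      gcongr
      exact (H.lintegral_exp_le _).trans
        (ENNReal.ofReal_le_ofReal (Real.exp_le_exp.2 (hc 0 0)))

/-- A constant shift is adapted. This serves to assemble the coordinates of a Gaussian vector, and
the noise vectors of all machines in one round. -/
theorem pi [MeasurableAdd₂ E] [IsProbabilityMeasure μ] (H : IsShiftCost μ lam ℓ q) (n : ℕ) :
    IsShiftCost (Measure.pi fun _ : Fin n => μ) lam (fun v y => ∑ t, ℓ (v t) (y t))
      (fun v => ∑ t, q (v t)) where
  measurable := Finset.measurable_sum _ fun t _ => by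
    have h : Measurable fun p : (Fin n → E) × (Fin n → E) => (p.1 t, p.2 t) := by fun_prop
    exact H.measurable.comp h
  lintegral_shift v h hh := H.lintegral_adapted_shift (fun t _ => v t)
    (fun _ => measurable_const) (fun _ _ _ _ => rfl) h hh
  lintegral_exp_le v := H.lintegral_exp_adapted_le (fun t _ => v t)
    (fun _ => measurable_const) (fun _ _ _ _ => rfl) _ fun _ _ => le_rfl

/-- Chernoff bound on the privacy loss `l`: where `l ≤ ε` the density ratio costs at most `exp ε`,
and where `l ≥ ε` the indicator is at most `exp (lam * (l - ε))`, whose integral is at most `δ`. -/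
theorem measure_adapted_shift_le [MeasurableAdd₂ E] [IsProbabilityMeasure μ]
    (H : IsShiftCost μ lam ℓ q) {n : ℕ}
    (v : Fin n → (Fin n → E) → E) (hv : ∀ t, Measurable (v t))
    (had : ∀ t y y', (∀ s < t, y s = y' s) → v t y = v t y')
    (c : Fin n → ℝ) (hc : ∀ t y, q (v t y) ≤ c t) (hlam : 0 ≤ lam) {ε δ : ℝ}
    (hδ : Real.exp (∑ t, c t - lam * ε) ≤ δ) (A : Set (Fin n → E)) (hA : MeasurableSet A) :
    Measure.pi (fun _ => μ) {y | (fun t => y t + v t y) ∈ A} ≤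
      ENNReal.ofReal (Real.exp ε) * Measure.pi (fun _ => μ) A + ENNReal.ofReal δ := by
  set l : (Fin n → E) → ℝ := fun y => ∑ t, ℓ (v t y) (y t) with hl
  have hlm : Measurable l := Finset.measurable_sum _ fun t _ =>
    H.measurable.comp ((hv t).prodMk (measurable_pi_apply t))
  have hΦ : Measurable fun (y : Fin n → E) t => y t + v t y :=
    measurable_pi_lambda _ fun t => (measurable_pi_apply t).add (hv t)
  have hind : Measurable (A.indicator (1 : (Fin n → E) → ENNReal)) :=
    measurable_one.indicator hA
  have h1 := H.lintegral_adapted_shift v hv had _ hind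
  have h2 := H.lintegral_exp_adapted_le v hv had c hc
  rw [lintegral_indicator_one hA] at h1
  have hpt : ∀ y, (({y | (fun t => y t + v t y) ∈ A} : Set (Fin n → E)).indicator
      (1 : (Fin n → E) → ENNReal)) y ≤
      ENNReal.ofReal (Real.exp ε) * (A.indicator 1 (fun t => y t + v t y) *
        ENNReal.ofReal (Real.exp (-l y))) +
      ENNReal.ofReal (Real.exp (-(lam * ε))) * ENNReal.ofReal (Real.exp (lam * l y)) := by
    intro y
    by_cases hy : (fun t => y t + v t y) ∈ A
    · rw [Set.indicator_of_mem (by exact hy), Set.indicator_of_mem hy]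
      simp only [Pi.one_apply, one_mul]
      rw [← ENNReal.ofReal_mul (Real.exp_pos _).le, ← ENNReal.ofReal_mul (Real.exp_pos _).le,
        ← Real.exp_add, ← Real.exp_add]
      rcases le_total (l y) ε with h | h
      · refine le_add_right (ENNReal.one_le_ofReal.2 (Real.one_le_exp ?_))
        linarith
      · refine le_add_left (ENNReal.one_le_ofReal.2 (Real.one_le_exp ?_))
        nlinarith
    · rw [Set.indicator_of_notMem (by exact hy)]
      exact zero_le
  have hmeas : Measurable fun y => A.indicator (1 : (Fin n → E) → ENNReal)
      (fun t => y t + v t y) * ENNReal.ofReal (Real.exp (-l y)) :=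
    (hind.comp hΦ).mul hlm.neg.exp.ennreal_ofReal
  have hΦA : MeasurableSet {y : Fin n → E | (fun t => y t + v t y) ∈ A} := hΦ hA
  rw [← lintegral_indicator_one hΦA]
  refine (lintegral_mono hpt).trans ?_
  rw [lintegral_add_left (hmeas.const_mul _), lintegral_const_mul' _ _ ENNReal.ofReal_ne_top,
    lintegral_const_mul' _ _ ENNReal.ofReal_ne_top, h1]
  refine add_le_add le_rfl ((mul_le_mul_right h2 _).trans ?_)
  rw [← ENNReal.ofReal_mul (Real.exp_pos _).le, ← Real.exp_add]
  refine ENNReal.ofReal_le_ofReal (le_trans (le_of_eq ?_) hδ)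
  congr 1
  ring

theorem map {F : Type*} [MeasurableSpace F] [AddGroup F] [MeasurableAdd₂ F]
    (H : IsShiftCost μ lam ℓ q) (e : E → F) (e' : F → E) (he : Measurable e) (he' : Measurable e')
    (hadd : ∀ x y, e (x + y) = e x + e y) (h1 : ∀ x, e' (e x) = x) (h2 : ∀ y, e (e' y) = y) :
    IsShiftCost (μ.map e) lam (fun v y => ℓ (e' v) (e' y)) (fun v => q (e' v)) where
  measurable := H.measurable.comp ((he'.comp measurable_fst).prodMk (he'.comp measurable_snd))
  lintegral_shift v h hh := by
    have hm : Measurable fun y => ℓ (e' v) (e' y) :=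
      (H.measurable.comp measurable_prodMk_left).comp he'
    have hint : Measurable fun y => h (y + v) * ENNReal.ofReal (Real.exp (-ℓ (e' v) (e' y))) :=
      (hh.comp (measurable_id.add_const v)).mul hm.neg.exp.ennreal_ofReal
    rw [lintegral_map hint he, lintegral_map hh he,
      ← H.lintegral_shift (e' v) (fun y => h (e y)) (hh.comp he)]
    simp [hadd, h1, h2]
  lintegral_exp_le v := by
    have hm : Measurable fun y => ℓ (e' v) (e' y) :=
      (H.measurable.comp measurable_prodMk_left).comp he'
    rw [lintegral_map (hm.const_mul lam).exp.ennreal_ofReal he]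
    simpa [h1] using H.lintegral_exp_le (e' v)

end IsShiftCost

/-- Completing the square, the density at `y + v` is the one at `y` times `exp (-(v y + v ^ 2 /
2))`. The moment bound is an equality, from the Gaussian moment generating function at `lam * v`. -/
theorem isShiftCost_gaussianReal (lam : ℝ) :
    IsShiftCost (gaussianReal 0 1) lam (fun v y => v * y + v ^ 2 / 2)
      (fun v => lam * (lam + 1) / 2 * v ^ 2) where
  measurable := by unfold Function.uncurry; fun_prop
  lintegral_shift v h hh := by
    have hv : gaussianReal 0 1 = volume.withDensity (gaussianPDF 0 1) :=
      gaussianReal_of_var_ne_zero _ one_ne_zero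
    have hpdf : Measurable (gaussianPDF 0 1) := measurable_gaussianPDF _ _
    rw [hv, lintegral_withDensity_eq_lintegral_mul _ hpdf (by fun_prop),
      lintegral_withDensity_eq_lintegral_mul _ hpdf hh,
      ← lintegral_add_right_eq_self (gaussianPDF 0 1 * h) v]
    refine lintegral_congr fun y => ?_
    have : gaussianPDF 0 1 (y + v) =
        gaussianPDF 0 1 y * ENNReal.ofReal (Real.exp (-(v * y + v ^ 2 / 2))) := by
      simp only [gaussianPDF, gaussianPDFReal]
      rw [← ENNReal.ofReal_mul (by positivity), mul_assoc (√_)⁻¹, ← Real.exp_add]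
      congr 3
      simp
      ring
    simp only [Pi.mul_apply, this]
    ring
  lintegral_exp_le v := by
    have h1 : ∀ y : ℝ, Real.exp (lam * (v * y + v ^ 2 / 2)) =
        Real.exp (lam * v ^ 2 / 2) * Real.exp (lam * v * y) := fun y => by
      rw [← Real.exp_add]; congr 1; ring
    have hint : Integrable (fun y => Real.exp (lam * (v * y + v ^ 2 / 2))) (gaussianReal 0 1) := by
      simp only [h1]
      exact (integrable_exp_mul_gaussianReal _).const_mul _
    rw [← ofReal_integral_eq_lintegral_ofReal hint (ae_of_all _ fun y => (Real.exp_pos _).le)]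
    apply ENNReal.ofReal_le_ofReal
    have hm := mgf_gaussianReal (p := gaussianReal 0 1) (X := id) (μ := 0) (v := 1)
      (by simp) (lam * v)
    simp only [mgf, id] at hm
    simp only [h1]
    rw [integral_const_mul, hm, ← Real.exp_add]
    apply le_of_eq
    congr 1
    simp
    ring

theorem map_stdGaussian_smul (d : ℕ) (s : ℝ) :
    (stdGaussian (Vec d)).map (fun v => s • v) =
      (Measure.pi fun _ : Fin d => gaussianReal 0 1).map fun y => s • WithLp.toLp 2 y := by
  rw [← map_pi_eq_stdGaussian, Measure.map_map (by fun_prop) (by fun_prop)]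
  rfl

/-- The vector law is the image of a product of real Gaussians under an additive bijection, and the
one-dimensional costs sum to a multiple of the squared norm. The form of `ℓ` is irrelevant later,
hence the existential. -/
theorem isShiftCost_gaussian (lam : ℝ) (d : ℕ) {s : ℝ} (hs : s ≠ 0) :
    ∃ ℓ, IsShiftCost ((stdGaussian (Vec d)).map fun v => s • v) lam ℓ
      (fun v => lam * (lam + 1) / 2 * (‖v‖ / s) ^ 2) := by
  have h := ((isShiftCost_gaussianReal lam).pi d).map
    (fun y => s • (WithLp.toLp 2 y : Vec d)) (fun v => (s⁻¹ • v).ofLp)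
    (by fun_prop) (by fun_prop) (fun x y => by simp) (fun x => by simp [smul_smul, hs])
    (fun y => by simp [smul_smul, hs])
  rw [← map_stdGaussian_smul] at h
  refine ⟨fun v y => ∑ t, ((s⁻¹ • v).ofLp t * (s⁻¹ • y).ofLp t + (s⁻¹ • v).ofLp t ^ 2 / 2), ?_⟩
  have hq : (fun v : Vec d => lam * (lam + 1) / 2 * (‖v‖ / s) ^ 2) =
      fun v => ∑ t, lam * (lam + 1) / 2 * (s⁻¹ • v).ofLp t ^ 2 := by
    funext v
    rw [← Finset.mul_sum, div_pow, EuclideanSpace.real_norm_sq_eq]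
    congr 1
    simp [mul_pow, div_eq_inv_mul, Finset.mul_sum]
  rw [hq]
  exact h


/-! ### The Euclidean projection -/

section Projection

variable {d : ℕ} {K : Set (Vec d)}

lemma projPoint_spec (hK : IsCompact K) (hne : K.Nonempty) (x : Vec d) :
    Timed.projPoint K x ∈ K ∧ ∀ y ∈ K, ‖x - Timed.projPoint K x‖ ≤ ‖x - y‖ := by
  refine Classical.epsilon_spec (p := fun y => y ∈ K ∧ ∀ y' ∈ K, ‖x - y‖ ≤ ‖x - y'‖) ?_
  obtain ⟨y, hy, hmin⟩ := hK.exists_isMinOn hne (f := fun y => ‖x - y‖) (by fun_prop)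
  exact ⟨y, hy, fun y' hy' => hmin hy'⟩

lemma projPoint_mem (hK : IsCompact K) (hne : K.Nonempty) (x : Vec d) :
    Timed.projPoint K x ∈ K :=
  (projPoint_spec hK hne x).1

lemma inner_sub_projPoint_le (hconv : Convex ℝ K) (hK : IsCompact K) (hne : K.Nonempty)
    (x : Vec d) {y : Vec d} (hy : y ∈ K) :
    inner ℝ (x - Timed.projPoint K x) (y - Timed.projPoint K x) ≤ 0 := by
  obtain ⟨hmem, hmin⟩ := projPoint_spec hK hne x
  refine (norm_eq_iInf_iff_real_inner_le_zero hconv hmem).1 ?_ y hy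
  have : Nonempty K := hne.to_subtype
  refine le_antisymm (le_ciInf fun y => hmin y y.2) ?_
  exact ciInf_le ⟨0, by rintro _ ⟨y, rfl⟩; exact norm_nonneg _⟩ (⟨_, hmem⟩ : K)

lemma projPoint_of_mem (hK : IsCompact K) {x : Vec d} (hx : x ∈ K) : Timed.projPoint K x = x := by
  have h := (projPoint_spec hK ⟨x, hx⟩ x).2 x hx
  simp only [sub_self, norm_zero, norm_le_zero_iff] at h
  exact (sub_eq_zero.1 h).symm

/-- Adding the variational inequalities at the two projections gives firm nonexpansiveness.
Continuity of the projection is what makes the run measurable. -/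
lemma lipschitzWith_projPoint (hconv : Convex ℝ K) (hK : IsCompact K) (hne : K.Nonempty) :
    LipschitzWith 1 (Timed.projPoint K) := by
  refine LipschitzWith.of_dist_le_mul fun x y => ?_
  rw [NNReal.coe_one, one_mul, dist_eq_norm, dist_eq_norm]
  set p := Timed.projPoint K x
  set r := Timed.projPoint K y
  have h1 : inner ℝ (x - p) (r - p) ≤ 0 :=
    inner_sub_projPoint_le hconv hK hne x (projPoint_mem hK hne y)
  have h2 : inner ℝ (y - r) (p - r) ≤ 0 :=
    inner_sub_projPoint_le hconv hK hne y (projPoint_mem hK hne x)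
  have h3 : ‖p - r‖ * ‖p - r‖ ≤ inner ℝ (x - y) (p - r) := by
    rw [← real_inner_self_eq_norm_mul_norm]
    have : inner ℝ (x - y) (p - r) =
        inner ℝ (p - r) (p - r) - inner ℝ (x - p) (r - p) - inner ℝ (y - r) (p - r) := by
      rw [← neg_sub p r, inner_neg_right, sub_neg_eq_add, ← inner_add_left, ← inner_sub_left]
      congr 1
      abel
    linarith
  by_contra! hlt
  have h4 := real_inner_le_norm (x - y) (p - r)
  have h5 : 0 < ‖p - r‖ := (norm_nonneg _).trans_lt hlt
  nlinarith

end Projection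

/-! ### The run of the algorithm -/

lemma impWeightSum_eq (t : ℕ) : impWeightSum t = t * (t + 1) / 2 := by
  induction t with
  | zero => simp [impWeightSum]
  | succ t ih =>
      unfold impWeightSum at ih ⊢
      rw [Finset.sum_Icc_succ_top (by omega), ih, impWeight]
      push_cast
      ring

section Run

variable {d M n : ℕ} {Z : Fin M → Type*} {K : Set (Vec d)} {g : ∀ i, Vec d → Z i → Vec d}
  {η : ℝ} {x₁ : Vec d}

/-- The state after `t` rounds. -/
def stateAt (K : Set (Vec d)) (g : ∀ i, Vec d → Z i → Vec d) (η : ℝ) (x₁ : Vec d)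
    (S : Datasets Z n) (Y : Noise d M n) (t : ℕ) (ht : t ≤ n) : State d M :=
  (run K g η x₁ S Y t ht).val

lemma stateAt_zero (S : Datasets Z n) (Y : Noise d M n) (ht : 0 ≤ n) :
    stateAt K g η x₁ S Y 0 ht = initState M x₁ := rfl

variable (S : Datasets Z n) (Y : Noise d M n) (t : ℕ) (ht : t < n)

lemma stateAt_succ_mom (i : Fin M) : (stateAt K g η x₁ S Y (t + 1) ht).mom i =
    g i (stateAt K g η x₁ S Y t ht.le).x (S i ⟨t, ht⟩) + (1 - momWeight (t + 1)) •
      ((stateAt K g η x₁ S Y t ht.le).mom i -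
        g i (stateAt K g η x₁ S Y t ht.le).xprev (S i ⟨t, ht⟩)) := rfl

lemma stateAt_succ_msg (i : Fin M) : (stateAt K g η x₁ S Y (t + 1) ht).msg i =
    impWeight (t + 1) • (stateAt K g η x₁ S Y (t + 1) ht).mom i + Y ⟨t, ht⟩ i := rfl

lemma stateAt_succ_w : (stateAt K g η x₁ S Y (t + 1) ht).w =
    Timed.projPoint K ((stateAt K g η x₁ S Y t ht.le).w -
      η • (1 / (M : ℝ)) • ∑ i, (stateAt K g η x₁ S Y (t + 1) ht).msg i) := rfl

lemma stateAt_succ_x : (stateAt K g η x₁ S Y (t + 1) ht).x =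
    (impWeightSum (t + 1) / impWeightSum (t + 2)) • (stateAt K g η x₁ S Y t ht.le).x +
      (impWeight (t + 2) / impWeightSum (t + 2)) • (stateAt K g η x₁ S Y (t + 1) ht).w := rfl

lemma stateAt_succ_xprev : (stateAt K g η x₁ S Y (t + 1) ht).xprev =
    (stateAt K g η x₁ S Y t ht.le).x := rfl

lemma grads_fullRun : (fullRun K g η x₁ S Y).grads = 2 * (n * M) := by
  have : ∀ t (ht : t ≤ n), (run K g η x₁ S Y t ht).grads = t * (2 * M) := by
    intro t
    induction t with
    | zero => intro ht; simp [run, Timed.pure]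
    | succ t ih =>
        intro ht
        have h : (run K g η x₁ S Y (t + 1) ht).grads = (run K g η x₁ S Y t (by omega)).grads +
            (∑ _ : Fin M, 2 + 0) := rfl
        rw [h, ih]
        simp
        ring
  rw [fullRun, this]
  ring

lemma ops_fullRun : (fullRun K g η x₁ S Y).ops = n * (7 * M + 7) := by
  have : ∀ t (ht : t ≤ n), (run K g η x₁ S Y t ht).ops = t * (7 * M + 7) := by
    intro t
    induction t with
    | zero => intro ht; simp [run, Timed.pure]
    | succ t ih =>
        intro ht
        -- Six operations on each machine; on the server `M` additions for the sum and seven further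
        -- steps.
        have h : (run K g η x₁ S Y (t + 1) ht).ops = (run K g η x₁ S Y t (by omega)).ops +
            (∑ _ : Fin M, 6 + (M + 7)) := rfl
        rw [h, ih]
        simp
        ring
  rw [fullRun, this]

/-- The states of a run depend only on the samples and the noise of the rounds before. -/
lemma stateAt_congr {S S' : Datasets Z n} {Y Y' : Noise d M n} {t : ℕ} (ht : t ≤ n)
    (hS : ∀ s : Fin n, s.1 < t → ∀ i, S i s = S' i s) (hY : ∀ s : Fin n, s.1 < t → Y s = Y' s) :
    stateAt K g η x₁ S Y t ht = stateAt K g η x₁ S' Y' t ht := by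
  induction t with
  | zero => rfl
  | succ t ih =>
      have ih := ih (by omega) (fun s hs => hS s (by omega)) (fun s hs => hY s (by omega))
      have h : ∀ (S : Datasets Z n) (Y : Noise d M n), stateAt K g η x₁ S Y (t + 1) ht =
          (round K g η (t + 1) (fun i => S i ⟨t, ht⟩) (Y ⟨t, ht⟩)
            (stateAt K g η x₁ S Y t (by omega))).val := fun _ _ => rfl
      rw [h, h, ih, hY ⟨t, ht⟩ (Nat.lt_succ_self t)]
      have : (fun i => S i ⟨t, ht⟩) = fun i => S' i ⟨t, ht⟩ :=
        funext fun i => hS ⟨t, ht⟩ (Nat.lt_succ_self t) i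
      rw [this]

/-- The contribution of the sample `z` to the weighted momentum of one machine, after `t` complete
rounds. -/
def momIncr {Z : Type*} (g : Vec d → Z → Vec d) (t : ℕ) (s : State d M) (z : Z) : Vec d :=
  g s.x z + (t : ℝ) • (g s.x z - g s.xprev z)

/-- The corrected momentum is a plain sum in disguise, because `α_{t+1} (1 - β_{t+1}) = α_t`. The
old momentum is carried over undamped, and a sample is never used again after its round. -/
lemma impWeight_smul_mom (i : Fin M) :
    impWeight (t + 1) • (stateAt K g η x₁ S Y (t + 1) ht).mom i =
      impWeight t • (stateAt K g η x₁ S Y t ht.le).mom i +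
        momIncr (g i) t (stateAt K g η x₁ S Y t ht.le) (S i ⟨t, ht⟩) := by
  rw [stateAt_succ_mom, momIncr, smul_add, smul_smul]
  have h : impWeight (t + 1) * (1 - momWeight (t + 1)) = t := by
    have : ((t : ℝ) + 1) ≠ 0 := by positivity
    simp only [momWeight, impWeight]
    push_cast
    field_simp
    ring
  rw [h]
  simp only [impWeight, Nat.cast_succ]
  module

lemma stateAt_mem (hconv : Convex ℝ K) (hK : IsCompact K) (hx₁ : x₁ ∈ K) {t : ℕ}
    (ht : t ≤ n) : (stateAt K g η x₁ S Y t ht).w ∈ K ∧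
    (stateAt K g η x₁ S Y t ht).x ∈ K ∧ (stateAt K g η x₁ S Y t ht).xprev ∈ K := by
  induction t with
  | zero => exact ⟨hx₁, hx₁, hx₁⟩
  | succ t ih =>
      obtain ⟨-, h2, -⟩ := ih (by omega)
      have hw : (stateAt K g η x₁ S Y (t + 1) ht).w ∈ K := projPoint_mem hK ⟨x₁, hx₁⟩ _
      refine ⟨hw, ?_, h2⟩
      rw [stateAt_succ_x]
      refine hconv h2 hw ?_ ?_ ?_ <;> simp only [impWeightSum_eq, impWeight] <;> push_cast
      · positivity
      · positivity
      · field_simp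
        ring

/-- The new point `w` enters the average with weight `α_{t+2} / α_{1:t+2} = 2 / (t + 3)`, so a move
of the query point is at most `2B / (t + 3)`. -/
lemma norm_x_sub_xprev_le (hconv : Convex ℝ K) (hK : IsCompact K) (hx₁ : x₁ ∈ K) {B : ℝ}
    (hdiam : ∀ x ∈ K, ∀ y ∈ K, ‖x - y‖ ≤ B) {t : ℕ}
    (ht : t ≤ n) :
    t * ‖(stateAt K g η x₁ S Y t ht).x - (stateAt K g η x₁ S Y t ht).xprev‖ ≤ 2 * B := by
  have hB : 0 ≤ B := (norm_nonneg _).trans (hdiam _ hx₁ _ hx₁)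
  cases t with
  | zero => simpa using hB
  | succ t =>
      have h1 : (stateAt K g η x₁ S Y (t + 1) ht).x - (stateAt K g η x₁ S Y (t + 1) ht).xprev =
          (2 / ((t : ℝ) + 3)) • ((stateAt K g η x₁ S Y (t + 1) ht).w -
            (stateAt K g η x₁ S Y t (Nat.le_of_succ_le ht)).x) := by
        rw [stateAt_succ_xprev, stateAt_succ_x]
        have e1 : impWeightSum (t + 1) / impWeightSum (t + 2) = 1 - 2 / ((t : ℝ) + 3) := by
          simp only [impWeightSum_eq]
          push_cast
          field_simp
          ring
        have e2 : impWeight (t + 2) / impWeightSum (t + 2) = 2 / ((t : ℝ) + 3) := by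
          simp only [impWeightSum_eq, impWeight]
          push_cast
          field_simp
          ring
        rw [e1, e2]
        module
      have h2 := hdiam _ (stateAt_mem (g := g) (η := η) S Y hconv hK hx₁ ht).1 _
        (stateAt_mem (g := g) (η := η) S Y hconv hK hx₁ (Nat.le_of_succ_le ht)).2.1
      rw [h1, norm_smul, Real.norm_of_nonneg (by positivity), ← mul_assoc]
      refine mul_le_mul ?_ h2 (norm_nonneg _) zero_le_two
      push_cast
      rw [mul_div_assoc', div_le_iff₀ (by positivity)]
      linarith

/-- At interior points the Lipschitz constant bounds the derivative. The bound passes to all of `K`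
because the gradient is continuous and a convex set with interior points lies in the closure of its
interior. -/
lemma IsSmoothLoss.norm_grad_le' {Z : Type*} {f : Vec d → Z → ℝ} {g : Vec d → Z → Vec d} {G L : ℝ}
    (hf : IsSmoothLoss K f g G L) (hconv : Convex ℝ K) (hG : 0 ≤ G) (z : Z)
    {x : Vec d} (hx : x ∈ K) : ‖g x z‖ ≤ G := by
  rcases Set.eq_empty_or_nonempty (interior K) with h | h
  · exact hf.norm_grad_le h z x hx
  have hcont : ContinuousOn (fun x => g x z) K :=
    (LipschitzOnWith.of_dist_le_mul (K := Real.toNNReal L) fun x hx y hy => by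
      rw [dist_eq_norm, dist_eq_norm]
      exact (hf.smooth z x hx y hy).trans
        (mul_le_mul_of_nonneg_right (Real.le_coe_toNNReal L) (norm_nonneg _))).continuousOn
  have hint : ∀ y ∈ interior K, ‖g y z‖ ≤ G := by
    intro y hy
    have hnhds : K ∈ nhds y := mem_interior_iff_mem_nhds.1 hy
    have hd := ((hf.hasGradient z y (interior_subset hy)).hasFDerivWithinAt).hasFDerivAt hnhds
    have := hd.le_of_lipschitzOn hnhds (C := Real.toNNReal G)
      (LipschitzOnWith.of_dist_le_mul fun a ha b hb => by
        rw [dist_eq_norm, dist_eq_norm, Real.coe_toNNReal _ hG]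
        exact hf.lipschitz z a ha b hb)
    simpa [Real.coe_toNNReal _ hG] using this
  have hcl : x ∈ closure (interior K) := by
    rw [hconv.closure_interior_eq_closure_of_nonempty_interior h]
    exact subset_closure hx
  have hc : ContinuousWithinAt (fun x => ‖g x z‖) (interior K) x :=
    ((hcont x hx).mono interior_subset).norm
  exact closure_minimal (s := {r | r ≤ G}) (fun _ h => h) isClosed_Iic
    (hc.mem_closure hcl fun y hy => hint y hy)

/-- This is the sensitivity bound: smoothness turns the large factor `t` into `t * ‖x - xprev‖`,
which stays bounded. -/
lemma norm_momIncr_le {Z : Type*} {f : Vec d → Z → ℝ} {g : Vec d → Z → Vec d} {B G L : ℝ}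
    (hf : IsSmoothLoss K f g G L) (hconv : Convex ℝ K) (hG : 0 ≤ G) (hL : 0 ≤ L) (t : ℕ)
    {s : State d M} (hx : s.x ∈ K) (hxp : s.xprev ∈ K) (hs : t * ‖s.x - s.xprev‖ ≤ 2 * B) (z : Z) :
    ‖momIncr g t s z‖ ≤ sens G L B := by
  refine (norm_add_le _ _).trans (add_le_add (hf.norm_grad_le' hconv hG z hx) ?_)
  rw [norm_smul, Real.norm_of_nonneg (Nat.cast_nonneg t)]
  have := hf.smooth z _ hx _ hxp
  calc (t : ℝ) * ‖g s.x z - g s.xprev z‖ ≤ t * (L * ‖s.x - s.xprev‖) := by gcongr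
    _ = L * (t * ‖s.x - s.xprev‖) := by ring
    _ ≤ L * (2 * B) := by gcongr
    _ = 2 * L * B := by ring

/-! ### Measurability of the run -/

/-- The datasets are a function of `ω` so that both fixed data, for privacy, and random data, for
the excess loss, are covered. -/
lemma measurable_stateAt {Ω : Type*} [MeasurableSpace Ω] (hconv : Convex ℝ K) (hK : IsCompact K)
    (hx₁ : x₁ ∈ K) (S : Ω → Datasets Z n) (Y : Ω → Noise d M n) (hY : Measurable Y)
    (hg : ∀ i t (x : Ω → Vec d), Measurable x → (∀ ω, x ω ∈ K) →
      Measurable fun ω => g i (x ω) (S ω i t)) {t : ℕ} (ht : t ≤ n) :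
    (Measurable fun ω => (stateAt K g η x₁ (S ω) (Y ω) t ht).w) ∧
    (Measurable fun ω => (stateAt K g η x₁ (S ω) (Y ω) t ht).x) ∧
    (Measurable fun ω => (stateAt K g η x₁ (S ω) (Y ω) t ht).xprev) ∧
    (∀ i, Measurable fun ω => (stateAt K g η x₁ (S ω) (Y ω) t ht).mom i) ∧
    (∀ i, Measurable fun ω => (stateAt K g η x₁ (S ω) (Y ω) t ht).msg i) := by
  induction t with
  | zero =>
      exact ⟨measurable_const, measurable_const, measurable_const, fun _ => measurable_const,
        fun _ => measurable_const⟩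
  | succ t ih =>
      obtain ⟨h1, h2, h3, h4, -⟩ := ih (by omega)
      have hmom : ∀ i, Measurable fun ω => (stateAt K g η x₁ (S ω) (Y ω) (t + 1) ht).mom i := by
        intro i
        simp only [stateAt_succ_mom]
        exact (hg i _ _ h2 fun ω => (stateAt_mem _ _ hconv hK hx₁ _).2.1).add
          (((h4 i).sub (hg i _ _ h3 fun ω => (stateAt_mem _ _ hconv hK hx₁ _).2.2)).const_smul
            (1 - momWeight (t + 1)))
      have hmsg : ∀ i, Measurable fun ω => (stateAt K g η x₁ (S ω) (Y ω) (t + 1) ht).msg i := by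
        intro i
        simp only [stateAt_succ_msg]
        have : Measurable fun ω => Y ω ⟨t, ht⟩ i := by fun_prop
        exact ((hmom i).const_smul (impWeight (t + 1))).add this
      have hw : Measurable fun ω => (stateAt K g η x₁ (S ω) (Y ω) (t + 1) ht).w := by
        simp only [stateAt_succ_w]
        refine (lipschitzWith_projPoint hconv hK ⟨x₁, hx₁⟩).continuous.measurable.comp ?_
        have hsum : Measurable fun ω => ∑ i, (stateAt K g η x₁ (S ω) (Y ω) (t + 1) ht).msg i :=
          Finset.measurable_sum _ fun i _ => hmsg i
        exact h1.sub ((hsum.const_smul (1 / (M : ℝ))).const_smul η)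
      refine ⟨hw, ?_, h2, hmom, hmsg⟩
      simp only [stateAt_succ_x]
      exact (h2.const_smul (impWeightSum (t + 1) / impWeightSum (t + 2))).add
        (hw.const_smul (impWeight (t + 2) / impWeightSum (t + 2)))

end Run


/-! ### Privacy -/

section Parameters

variable {ε δ : ℝ}

lemma budget_pos (hε : 0 < ε) (hδ : 0 < δ) (hδ1 : δ < 1) : 0 < budget ε δ := by
  have hl : 0 < Real.log (1 / δ) := Real.log_pos (by rw [lt_div_iff₀ hδ]; linarith)
  exact sub_pos.2 (Real.sqrt_lt_sqrt (by positivity) (by linarith))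

lemma budget_eq (hε : 0 < ε) (hδ : 0 < δ) (hδ1 : δ < 1) :
    budget ε δ ^ 2 / 2 + budget ε δ * √(2 * Real.log (1 / δ)) = ε := by
  have hl : 0 < Real.log (1 / δ) := Real.log_pos (by rw [lt_div_iff₀ hδ]; linarith)
  have h1 := Real.sq_sqrt (show 0 ≤ 2 * (ε + Real.log (1 / δ)) by positivity)
  have h2 := Real.sq_sqrt (show 0 ≤ 2 * Real.log (1 / δ) by positivity)
  unfold budget
  nlinarith

end Parameters

section Privacy

variable {d M n : ℕ} {Z : Fin M → Type*} {K : Set (Vec d)} {g : ∀ i, Vec d → Z i → Vec d}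
  {η : ℝ} {x₁ : Vec d}

/-- The change of the weighted momentum of machine `i` if its sample of round `t + 1` is replaced,
and all messages of the earlier rounds are kept. -/
def momShift (K : Set (Vec d)) (g : ∀ i, Vec d → Z i → Vec d) (η : ℝ) (x₁ : Vec d) (i : Fin M)
    (S S' : Datasets Z n) (t : Fin n) (Y : Noise d M n) : Vec d :=
  momIncr (g i) t (stateAt K g η x₁ S Y t t.2.le) (S i t) -
    momIncr (g i) t (stateAt K g η x₁ S Y t t.2.le) (S' i t)

/-- The change of the noise of round `s + 1` that hides a replacement of the sample of round
`t + 1`. -/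
def noiseShift (K : Set (Vec d)) (g : ∀ i, Vec d → Z i → Vec d) (η : ℝ) (x₁ : Vec d) (i : Fin M)
    (S S' : Datasets Z n) (t s : Fin n) (Y : Noise d M n) : Fin M → Vec d :=
  if t ≤ s then Pi.single i (momShift K g η x₁ i S S' t Y) else 0

/-- The coupling behind privacy. Up to the replaced sample the runs agree. From then on the weighted
momentum of machine `i` differs by the constant vector `momShift`, which the shifted noise restores
in every message; hence the server, and with it all query points, cannot tell the runs apart. -/
lemma stateAt_noiseShift {i : Fin M} {S S' : Datasets Z n} {t₀ : Fin n}
    (hj : ∀ j, j ≠ i → S j = S' j) (hi : ∀ s, s ≠ t₀ → S i s = S' i s) (Y : Noise d M n)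
    {t : ℕ} (ht : t ≤ n) :
    let A := stateAt K g η x₁ S Y t ht
    let A' := stateAt K g η x₁ S' (fun s => Y s + noiseShift K g η x₁ i S S' t₀ s Y) t ht
    A.w = A'.w ∧ A.x = A'.x ∧ A.xprev = A'.xprev ∧ A.msg = A'.msg ∧
      ∀ j, impWeight t • A.mom j = impWeight t • A'.mom j +
        if t₀.1 < t then
          (Pi.single i (momShift K g η x₁ i S S' t₀ Y) : Fin M → Vec d) j else 0 := by
  set Y' : Noise d M n := fun s => Y s + noiseShift K g η x₁ i S S' t₀ s Y with hY'
  induction t with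
  | zero => simp [stateAt_zero, impWeight]
  | succ t ih =>
      have htn : t < n := ht
      obtain ⟨h1, h2, h3, -, h5⟩ := ih htn.le
      have hinc : ∀ j z, momIncr (g j) t (stateAt K g η x₁ S' Y' t htn.le) z =
          momIncr (g j) t (stateAt K g η x₁ S Y t htn.le) z := fun j z => by
        simp only [momIncr, h2, h3]
      have hmom : ∀ j, impWeight (t + 1) • (stateAt K g η x₁ S Y (t + 1) ht).mom j =
          impWeight (t + 1) • (stateAt K g η x₁ S' Y' (t + 1) ht).mom j +
          if t₀.1 < t + 1 then
            (Pi.single i (momShift K g η x₁ i S S' t₀ Y) : Fin M → Vec d) j else 0 := by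
        intro j
        rw [impWeight_smul_mom, impWeight_smul_mom, h5, hinc]
        rcases eq_or_ne j i with rfl | hne
        · rcases lt_trichotomy t₀.1 t with hlt | heq | hgt
          · rw [if_pos hlt, if_pos (by omega), hi ⟨t, htn⟩ (fun h => by simp [← h] at hlt)]
            abel
          · subst heq
            simp [momShift]
          · rw [if_neg (by omega), if_neg (by omega),
              hi ⟨t, htn⟩ (fun h => by simp [← h] at hgt)]
            abel
        · rw [hj j hne]
          simp [hne]
      have hmsg : (stateAt K g η x₁ S Y (t + 1) ht).msg =
          (stateAt K g η x₁ S' Y' (t + 1) ht).msg := by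
        funext j
        rw [stateAt_succ_msg, stateAt_succ_msg, hmom]
        simp only [hY', noiseShift, Fin.le_def, Nat.lt_succ_iff, Pi.add_apply]
        split_ifs
        · abel
        · simp
      have hw : (stateAt K g η x₁ S Y (t + 1) ht).w = (stateAt K g η x₁ S' Y' (t + 1) ht).w := by
        rw [stateAt_succ_w, stateAt_succ_w, hmsg, h1]
      refine ⟨hw, ?_, h2, hmsg, hmom⟩
      rw [stateAt_succ_x, stateAt_succ_x, hw, h2]

lemma transcript_noiseShift {i : Fin M} {S S' : Datasets Z n} {t₀ : Fin n}
    (hj : ∀ j, j ≠ i → S j = S' j) (hi : ∀ s, s ≠ t₀ → S i s = S' i s) (Y : Noise d M n) :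
    transcript K g η x₁ S Y =
      transcript K g η x₁ S' (fun s => Y s + noiseShift K g η x₁ i S S' t₀ s Y) := by
  funext t
  exact (stateAt_noiseShift hj hi Y (Nat.succ_le_of_lt t.2)).2.2.2.1

/-- A function continuous in `x` and measurable in `ω` is jointly measurable. Composing with the
projection extends `g` continuously from `K` to the whole space. -/
lemma measurable_comp_of_lipschitz {Ω : Type*} [MeasurableSpace Ω] {E : Type*}
    [NormedAddCommGroup E] [MeasurableSpace E] [BorelSpace E] {Z : Type*} {g : Vec d → Z → E}
    {L : ℝ} (hL : 0 ≤ L) (hg : ∀ z, ∀ x ∈ K, ∀ y ∈ K, ‖g x z - g y z‖ ≤ L * ‖x - y‖)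
    (hconv : Convex ℝ K) (hK : IsCompact K) (z : Ω → Z)
    (hgz : ∀ x ∈ K, Measurable fun ω => g x (z ω)) (x : Ω → Vec d) (hx : Measurable x)
    (hxK : ∀ ω, x ω ∈ K) : Measurable fun ω => g (x ω) (z ω) := by
  rcases isEmpty_or_nonempty Ω with h | ⟨⟨ω₀⟩⟩
  · exact measurable_of_empty _
  have hne : K.Nonempty := ⟨_, hxK ω₀⟩
  have hproj := lipschitzWith_projPoint hconv hK hne
  have hcont : ∀ ω, Continuous fun y => g (Timed.projPoint K y) (z ω) := fun ω => by
    refine (LipschitzWith.of_dist_le_mul (K := Real.toNNReal L) fun y y' => ?_).continuous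
    rw [dist_eq_norm, Real.coe_toNNReal _ hL]
    refine (hg (z ω) _ (projPoint_mem hK hne y) _ (projPoint_mem hK hne y')).trans ?_
    rw [← dist_eq_norm]
    gcongr
    simpa using hproj.dist_le_mul y y'
  have hmeas := measurable_uncurry_of_continuous_of_measurable hcont
    (fun y => hgz _ (projPoint_mem hK hne y))
  have h : (fun ω => g (x ω) (z ω)) =
      (Function.uncurry fun y ω => g (Timed.projPoint K y) (z ω)) ∘ fun ω => (x ω, ω) :=
    funext fun ω => by simp [Function.uncurry, projPoint_of_mem hK (hxK ω)]
  rw [h]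
  exact hmeas.comp (hx.prodMk measurable_id)

instance (d : ℕ) (s : ℝ) : IsProbabilityMeasure ((stdGaussian (Vec d)).map fun v => s • v) :=
  Measure.isProbabilityMeasure_map (by fun_prop)

variable {f : ∀ i, Vec d → Z i → ℝ} {B G L : ℝ}

lemma noiseStd_pos (hn : 1 ≤ n) (hB : 0 < B) (hG : 0 < G) (hL : 0 < L) {ε δ : ℝ} (hε : 0 < ε)
    (hδ : 0 < δ) (hδ1 : δ < 1) : 0 < noiseStd G L B ε δ n := by
  have := budget_pos hε hδ hδ1
  have : (0 : ℝ) < n := by exact_mod_cast hn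
  unfold noiseStd sens
  positivity

theorem isDP_transcript (hn : 1 ≤ n) (hconv : Convex ℝ K) (hK : IsCompact K) (hB : 0 < B)
    (hG : 0 < G) (hL : 0 < L) (hdiam : ∀ x ∈ K, ∀ y ∈ K, ‖x - y‖ ≤ B) (hx₁ : x₁ ∈ K)
    (hf : ∀ i, IsSmoothLoss K (f i) (g i) G L) {ε δ : ℝ} (hε : 0 < ε) (hδ : 0 < δ) (hδ1 : δ < 1)
    (η : ℝ) (i : Fin M) :
    IsDP (NeighboursAt i) (noiseLaw d M n (noiseStd G L B ε δ n))
      (transcript (n := n) K g η x₁) ε δ := by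
  rintro S S' ⟨hj, t₀, hi⟩ O hO
  have hmeas : ∀ S : Datasets Z n, ∀ i t (x : Noise d M n → Vec d), Measurable x →
      (∀ ω, x ω ∈ K) → Measurable fun ω => g i (x ω) (S i t) := fun S i t x hx hxK =>
    measurable_comp_of_lipschitz hL.le (hf i).smooth hconv hK (fun _ => S i t)
      (fun _ _ => measurable_const) x hx hxK
  have hstate := fun (S : Datasets Z n) t (ht : t ≤ n) =>
    measurable_stateAt (η := η) hconv hK hx₁ (fun _ => S) (fun Y : Noise d M n => Y)
      measurable_id (hmeas S) ht
  have htr : Measurable (transcript (n := n) K g η x₁ S') :=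
    measurable_pi_lambda _ fun t => measurable_pi_lambda _ fun j =>
      (hstate S' (t + 1) t.2).2.2.2.2 j
  have hmem := fun Y => stateAt_mem (g := g) (η := η) S Y hconv hK hx₁ t₀.2.le
  set ρ := budget ε δ with hρ_def
  have hρ : 0 < ρ := budget_pos hε hδ hδ1
  set s := noiseStd G L B ε δ n with hs_def
  have hs : 0 < s := noiseStd_pos hn hB hG hL hε hδ hδ1
  have hS : 0 < sens G L B := by unfold sens; positivity
  have hn0 : (0 : ℝ) < n := by exact_mod_cast hn
  set l := Real.log (1 / δ) with hl_def
  have hl : 0 < l := Real.log_pos (by rw [lt_div_iff₀ hδ]; linarith)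
  -- With `ε = ρ ^ 2 / 2 + ρ √(2l)` the Chernoff exponent `lam (lam + 1) / 2 * ρ ^ 2 - lam * ε`
  -- equals `(lam ρ) ^ 2 / 2 - lam ρ √(2l)`. This choice minimizes it, with value `-l = log δ`.
  set lam := √(2 * l) / ρ with hlam_def
  have hlam : 0 ≤ lam := by positivity
  obtain ⟨ℓ, H⟩ := isShiftCost_gaussian lam d hs.ne'
  have hshift : ∀ Y, ‖momShift K g η x₁ i S S' t₀ Y‖ ≤ 2 * sens G L B := by
    intro Y
    have hb := norm_x_sub_xprev_le (g := g) (η := η) S Y hconv hK hx₁ hdiam t₀.2.le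
    have := norm_momIncr_le (hf i) hconv hG.le hL.le t₀ (hmem Y).2.1 (hmem Y).2.2 hb (S i t₀)
    have := norm_momIncr_le (hf i) hconv hG.le hL.le t₀ (hmem Y).2.1 (hmem Y).2.2 hb (S' i t₀)
    refine (norm_sub_le _ _).trans ?_
    linarith
  have hshift_meas : Measurable (momShift K g η x₁ i S S' t₀) := by
    obtain ⟨-, h2, h3, -, -⟩ := hstate S t₀ t₀.2.le
    have hinc : ∀ S'' : Datasets Z n, Measurable fun Y : Noise d M n =>
        momIncr (g i) t₀ (stateAt K g η x₁ S Y t₀ t₀.2.le) (S'' i t₀) := fun S'' =>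
      (hmeas S'' i t₀ _ h2 fun Y => (hmem Y).2.1).add
        (((hmeas S'' i t₀ _ h2 fun Y => (hmem Y).2.1).sub
          (hmeas S'' i t₀ _ h3 fun Y => (hmem Y).2.2)).const_smul (t₀ : ℝ))
    exact (hinc S).sub (hinc S')
  -- One coordinate is the noise of all machines in one round, so adaptedness refers to earlier
  -- rounds.
  have key := (H.pi M).measure_adapted_shift_le (n := n) (noiseShift K g η x₁ i S S' t₀)
    (fun t => by
      unfold noiseShift
      split_ifs
      · refine measurable_pi_lambda _ fun j => ?_
        rcases eq_or_ne j i with rfl | hne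
        · simpa using hshift_meas
        · simp [hne]
      · exact measurable_const)
    (fun t Y Y' hYY' => by
      unfold noiseShift
      split_ifs with h
      · unfold momShift
        rw [stateAt_congr (S' := S) (Y' := Y') t₀.2.le (fun _ _ _ => rfl)
          (fun s hs => hYY' s (lt_of_lt_of_le (Fin.lt_def.2 hs) h))]
      · rfl)
    -- Rounds before `t₀` are charged too, although their shift is zero; this makes the total
    -- independent of `t₀`.
    (fun _ => lam * (lam + 1) / 2 * (2 * sens G L B / s) ^ 2)
    (fun t Y => by
      rw [← Finset.mul_sum]
      refine mul_le_mul_of_nonneg_left ?_ (by positivity)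
      unfold noiseShift
      split_ifs
      · rw [Finset.sum_eq_single i]
        · rw [Pi.single_eq_same]
          gcongr
          exact hshift Y
        · intro j _ hne
          simp [hne]
        · simp
      · simp only [Pi.zero_apply, norm_zero, zero_div, ne_eq, OfNat.ofNat_ne_zero,
          not_false_eq_true, zero_pow, Finset.sum_const_zero]
        positivity)
    hlam (ε := ε) (δ := δ)
    (by
      have h1 : (n : ℝ) * (2 * sens G L B / s) ^ 2 = ρ ^ 2 := by
        rw [hs_def, noiseStd, ← hρ_def]
        have := Real.sq_sqrt hn0.le
        field_simp
        rw [this]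
      have h2 := budget_eq hε hδ hδ1
      rw [← hρ_def, ← hl_def] at h2
      have h3 : lam * ρ = √(2 * l) := by rw [hlam_def]; field_simp
      have h4 := Real.sq_sqrt (show 0 ≤ 2 * l by positivity)
      have h5 : ∑ _ : Fin n, lam * (lam + 1) / 2 * (2 * sens G L B / s) ^ 2 - lam * ε = -l := by
        rw [Finset.sum_const, Finset.card_univ, Fintype.card_fin, nsmul_eq_mul]
        have : (n : ℝ) * (lam * (lam + 1) / 2 * (2 * sens G L B / s) ^ 2) =
            lam * (lam + 1) / 2 * ρ ^ 2 := by rw [← h1]; ring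
        rw [this, ← h2, ← h3]
        rw [← h3] at h4
        linear_combination (-1 / 2) * h4
      rw [h5, hl_def, one_div, Real.log_inv, neg_neg, Real.exp_log hδ])
    _ (htr hO)
  refine le_trans (le_of_eq ?_) key
  congr 1
  ext Y
  simp only [Set.mem_ofPred_eq, Set.mem_preimage]
  rw [transcript_noiseShift hj hi]

end Privacy


/-! ### Resampling one coordinate of a product measure -/

section Resample

lemma measurePreserving_prodAssoc' {α β γ : Type*} [MeasurableSpace α] [MeasurableSpace β]
    [MeasurableSpace γ] (P : Measure α) (Q : Measure β) (R : Measure γ) [SFinite P] [SFinite Q]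
    [SFinite R] : MeasurePreserving (MeasurableEquiv.prodAssoc : (α × β) × γ ≃ᵐ α × β × γ)
      ((P.prod Q).prod R) (P.prod (Q.prod R)) :=
  ⟨MeasurableEquiv.prodAssoc.measurable, Measure.prodAssoc_prod⟩

lemma measurePreserving_update {ι : Type*} [Fintype ι] [DecidableEq ι] {X : ι → Type*}
    [∀ i, MeasurableSpace (X i)] (μ : ∀ i, Measure (X i)) [∀ i, IsProbabilityMeasure (μ i)]
    (k : ι) : MeasurePreserving (fun p : (∀ i, X i) × X k => Function.update p.1 k p.2)
      ((Measure.pi μ).prod (μ k)) (Measure.pi μ) := by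
  have hm : Measurable fun p : (∀ i, X i) × X k => Function.update p.1 k p.2 := by
    refine measurable_pi_lambda _ fun i => ?_
    rcases eq_or_ne i k with rfl | h
    · simpa using measurable_snd
    · simp only [ne_eq, h, not_false_eq_true, Function.update_of_ne]
      fun_prop
  refine ⟨hm, (Measure.pi_eq fun s hs => ?_).symm⟩
  rw [Measure.map_apply hm (MeasurableSet.univ_pi hs)]
  have : (fun p : (∀ i, X i) × X k => Function.update p.1 k p.2) ⁻¹' (Set.univ.pi s) =
      (Set.univ.pi (Function.update s k Set.univ)) ×ˢ (s k) := by
    ext ⟨a, b⟩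
    simp only [Set.mem_preimage, Set.mem_pi, Set.mem_univ, true_implies, Set.mem_prod]
    constructor
    · intro h
      refine ⟨fun i => ?_, by simpa using h k⟩
      rcases eq_or_ne i k with rfl | hi
      · simp
      · simpa [hi] using h i
    · rintro ⟨h1, h2⟩ i
      rcases eq_or_ne i k with rfl | hi
      · simpa using h2
      · simpa [hi] using h1 i
  rw [this, Measure.prod_prod, Measure.pi_pi, ← Finset.prod_erase_mul _ _ (Finset.mem_univ k),
    ← Finset.prod_erase_mul Finset.univ _ (Finset.mem_univ k)]
  simp only [Function.update_self, measure_univ, mul_one]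
  congr 1
  refine Finset.prod_congr rfl fun i hi => ?_
  rw [Function.update_of_ne (Finset.ne_of_mem_erase hi)]

/-- The laws of data and noise are products of products. Here coordinate `k` is refreshed only in
part, by a map `R` that preserves its own law; writing the product law as the image of a law with a
fresh coordinate `k` reduces this to `measurePreserving_update`. -/
lemma measurePreserving_update_comp {ι : Type*} [Fintype ι] [DecidableEq ι] {X : ι → Type*}
    [∀ i, MeasurableSpace (X i)] (μ : ∀ i, Measure (X i)) [∀ i, IsProbabilityMeasure (μ i)]
    (k : ι) {A : Type*} [MeasurableSpace A] {ν : Measure A} [SFinite ν] {R : X k × A → X k}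
    (hR : MeasurePreserving R ((μ k).prod ν) (μ k)) :
    MeasurePreserving (fun p : (∀ i, X i) × A => Function.update p.1 k (R (p.1 k, p.2)))
      ((Measure.pi μ).prod ν) (Measure.pi μ) := by
  have hU := measurePreserving_update μ k
  have hV := hU.prod (MeasurePreserving.id ν)
  have hW := hU.comp (((MeasurePreserving.id (Measure.pi μ)).prod hR).comp
    (measurePreserving_prodAssoc' (Measure.pi μ) (μ k) ν))
  have hupd : Measurable fun p : (∀ i, X i) × X k => Function.update p.1 k p.2 := hU.measurable
  have hm : Measurable fun p : (∀ i, X i) × A => Function.update p.1 k (R (p.1 k, p.2)) := by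
    have h2 : Measurable fun p : (∀ i, X i) × A => R (p.1 k, p.2) :=
      hR.measurable.comp (by fun_prop)
    exact hupd.comp (measurable_fst.prodMk h2)
  refine ⟨hm, ?_⟩
  rw [← hV.map_eq, Measure.map_map hm hV.measurable]
  refine Eq.trans (congrArg (fun F => Measure.map F _) ?_) hW.map_eq
  funext p
  simp [MeasurableEquiv.prodAssoc]

variable {α β A : Type*} [MeasurableSpace α] [MeasurableSpace β] [MeasurableSpace A]
  {P : Measure α} {Q : Measure β} {ν : Measure A} [SFinite P] [SFinite Q] [SFinite ν]

lemma measurePreserving_prod_left {T : α × A → α} (hT : MeasurePreserving T (P.prod ν) P) :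
    MeasurePreserving (fun p : (α × β) × A => (T (p.1.1, p.2), p.1.2)) ((P.prod Q).prod ν)
      (P.prod Q) := by
  have h1 := measurePreserving_prodAssoc' P Q ν
  have h2 := (MeasurePreserving.id P).prod (Measure.measurePreserving_swap (μ := Q) (ν := ν))
  have h3 := (measurePreserving_prodAssoc' P ν Q).symm
  exact (hT.prod (MeasurePreserving.id Q)).comp (h3.comp (h2.comp h1))

lemma measurePreserving_prod_right {T : β × A → β} (hT : MeasurePreserving T (Q.prod ν) Q) :
    MeasurePreserving (fun p : (α × β) × A => (p.1.1, T (p.1.2, p.2))) ((P.prod Q).prod ν)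
      (P.prod Q) :=
  ((MeasurePreserving.id P).prod hT).comp (measurePreserving_prodAssoc' P Q ν)

/-- Resampling does not change the law, and by Fubini the fresh variable can be integrated first
with everything else frozen. This takes the role of a conditional expectation. -/
lemma integral_le_of_resample [IsProbabilityMeasure P] {T : α × A → α}
    (hT : MeasurePreserving T (P.prod ν) P) {h : α → ℝ} (hh : Integrable h P) {c : ℝ}
    (hc : ∀ ω, ∫ a, h (T (ω, a)) ∂ν ≤ c) : ∫ ω, h ω ∂P ≤ c := by
  have hi : Integrable (fun p => h (T p)) (P.prod ν) := hT.integrable_comp_of_integrable hh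
  have h1 : ∫ ω, h ω ∂P = ∫ ω, ∫ a, h (T (ω, a)) ∂ν ∂P := by
    rw [← integral_prod _ hi, ← integral_map hT.measurable.aemeasurable, hT.map_eq]
    rw [hT.map_eq]
    exact hh.aestronglyMeasurable
  rw [h1]
  calc ∫ ω, ∫ a, h (T (ω, a)) ∂ν ∂P ≤ ∫ _, c ∂P :=
        integral_mono hi.integral_prod_left (integrable_const c) hc
    _ = c := by simp

lemma integral_eq_zero_of_resample [IsProbabilityMeasure P] {T : α × A → α}
    (hT : MeasurePreserving T (P.prod ν) P) {h : α → ℝ} (hh : Integrable h P)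
    (h0 : ∀ ω, ∫ a, h (T (ω, a)) ∂ν = 0) : ∫ ω, h ω ∂P = 0 := by
  refine le_antisymm (integral_le_of_resample hT hh fun ω => (h0 ω).le) ?_
  have := integral_le_of_resample hT hh.neg (c := 0) fun ω => by
    simp only [Pi.neg_apply]
    rw [integral_neg, h0, neg_zero]
  simp only [Pi.neg_apply, integral_neg] at this
  linarith

end Resample

/-! ### Second moments -/

section SecondMoments

variable {Ω : Type*} [MeasurableSpace Ω] {P : Measure Ω} {E : Type*} [NormedAddCommGroup E]

lemma integrable_inner_of_memLp [InnerProductSpace ℝ E] {X Y : Ω → E}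
    (hX : MemLp X 2 P) (hY : MemLp Y 2 P) :
    Integrable (fun ω => inner ℝ (X ω) (Y ω)) P := by
  have h : (fun ω => inner ℝ (X ω) (Y ω)) =
      fun ω => (‖(X + Y) ω‖ ^ 2 - ‖X ω‖ ^ 2 - ‖Y ω‖ ^ 2) / 2 := by
    funext ω
    rw [Pi.add_apply, norm_add_sq_real]
    ring
  rw [h]
  exact ((((hX.add hY).integrable_norm_pow two_ne_zero).sub
    (hX.integrable_norm_pow two_ne_zero)).sub (hY.integrable_norm_pow two_ne_zero)).div_const 2

lemma integral_norm_sq_sum_le [InnerProductSpace ℝ E] {ι : Type*} {X : ι → Ω → E}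
    {c : ℝ} (s : Finset ι)
    (hX : ∀ k ∈ s, MemLp (X k) 2 P) (hc : ∀ k ∈ s, ∫ ω, ‖X k ω‖ ^ 2 ∂P ≤ c)
    (h0 : ∀ k ∈ s, ∀ j ∈ s, k ≠ j → ∫ ω, inner ℝ (X k ω) (X j ω) ∂P = 0) :
    ∫ ω, ‖∑ k ∈ s, X k ω‖ ^ 2 ∂P ≤ s.card * c := by
  classical
  induction s using Finset.induction_on with
  | empty => simp
  | insert a s ha ih =>
      have ih := ih (fun k hk => hX k (Finset.mem_insert_of_mem hk))
        (fun k hk => hc k (Finset.mem_insert_of_mem hk))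
        (fun k hk j hj => h0 k (Finset.mem_insert_of_mem hk) j (Finset.mem_insert_of_mem hj))
      have hXa := hX a (Finset.mem_insert_self a s)
      have hsum : MemLp (fun ω => ∑ k ∈ s, X k ω) 2 P :=
        memLp_finsetSum s fun k hk => hX k (Finset.mem_insert_of_mem hk)
      have h1 : ∀ ω, ‖∑ k ∈ insert a s, X k ω‖ ^ 2 = ‖X a ω‖ ^ 2 +
          2 * ∑ k ∈ s, inner ℝ (X a ω) (X k ω) + ‖∑ k ∈ s, X k ω‖ ^ 2 := fun ω => by
        rw [Finset.sum_insert ha, norm_add_sq_real, inner_sum]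
      have hin : ∀ k ∈ s, Integrable (fun ω => inner ℝ (X a ω) (X k ω)) P := fun k hk =>
        integrable_inner_of_memLp hXa (hX k (Finset.mem_insert_of_mem hk))
      have hz : ∫ ω, 2 * ∑ k ∈ s, inner ℝ (X a ω) (X k ω) ∂P = 0 := by
        rw [integral_const_mul, integral_finsetSum _ hin, Finset.sum_eq_zero, mul_zero]
        intro k hk
        exact h0 a (Finset.mem_insert_self a s) k (Finset.mem_insert_of_mem hk)
          fun h => ha (h ▸ hk)
      simp only [h1]
      rw [integral_add, integral_add, hz, Finset.card_insert_of_notMem ha]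
      · have := hc a (Finset.mem_insert_self a s)
        push_cast
        linarith
      · exact hXa.integrable_norm_pow two_ne_zero
      · exact (integrable_finsetSum _ hin).const_mul 2
      · exact (hXa.integrable_norm_pow two_ne_zero).add ((integrable_finsetSum _ hin).const_mul 2)
      · exact hsum.integrable_norm_pow two_ne_zero

/-- The variance of `‖X‖` is nonnegative. -/
lemma integral_norm_le_of_sq [IsProbabilityMeasure P] {X : Ω → E} (hX : MemLp X 2 P) {c : ℝ}
    (hc : 0 ≤ c) (h : ∫ ω, ‖X ω‖ ^ 2 ∂P ≤ c ^ 2) : ∫ ω, ‖X ω‖ ∂P ≤ c := by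
  have hi1 : Integrable (fun ω => ‖X ω‖) P := (hX.integrable one_le_two).norm
  have hi2 : Integrable (fun ω => ‖X ω‖ ^ 2) P := hX.integrable_norm_pow two_ne_zero
  set m := ∫ ω, ‖X ω‖ ∂P with hm
  have h1 : 0 ≤ ∫ ω, (‖X ω‖ - m) ^ 2 ∂P := integral_nonneg fun ω => sq_nonneg _
  have h2 : ∫ ω, (‖X ω‖ - m) ^ 2 ∂P = ∫ ω, ‖X ω‖ ^ 2 ∂P - m ^ 2 := by
    have : ∀ ω, (‖X ω‖ - m) ^ 2 = ‖X ω‖ ^ 2 - 2 * m * ‖X ω‖ + m ^ 2 := fun ω => by ring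
    simp only [this]
    have hi3 : Integrable (fun ω => ‖X ω‖ ^ 2 - 2 * m * ‖X ω‖) P := hi2.sub (hi1.const_mul _)
    rw [integral_add hi3 (integrable_const _), integral_sub hi2 (hi1.const_mul _),
      integral_const_mul, ← hm]
    simp
    ring
  exact le_of_sq_le_sq (by linarith) hc

/-- Minkowski's inequality in `L²`, by a weighted Young inequality whose weights `(p + q) / p` and
`(p + q) / q` lose nothing when `‖X‖ / p = ‖Y‖ / q`. -/
lemma integral_norm_add_sq_le {X Y : Ω → E} (hX : MemLp X 2 P) (hY : MemLp Y 2 P) {p q : ℝ}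
    (hp : 0 ≤ p) (hq : 0 ≤ q) (h1 : ∫ ω, ‖X ω‖ ^ 2 ∂P ≤ p ^ 2)
    (h2 : ∫ ω, ‖Y ω‖ ^ 2 ∂P ≤ q ^ 2) : ∫ ω, ‖X ω + Y ω‖ ^ 2 ∂P ≤ (p + q) ^ 2 := by
  have hiX := hX.integrable_norm_pow two_ne_zero
  have hiY := hY.integrable_norm_pow two_ne_zero
  have hpos : ∀ p q : ℝ, 0 < p → 0 < q → ∫ ω, ‖X ω‖ ^ 2 ∂P ≤ p ^ 2 →
      ∫ ω, ‖Y ω‖ ^ 2 ∂P ≤ q ^ 2 → ∫ ω, ‖X ω + Y ω‖ ^ 2 ∂P ≤ (p + q) ^ 2 := by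
    intro p q hp hq h1 h2
    have hpt : ∀ ω, ‖X ω + Y ω‖ ^ 2 ≤ (p + q) / p * ‖X ω‖ ^ 2 + (p + q) / q * ‖Y ω‖ ^ 2 := by
      intro ω
      have ht := norm_add_le (X ω) (Y ω)
      have h3 : ‖X ω + Y ω‖ ^ 2 ≤ (‖X ω‖ + ‖Y ω‖) ^ 2 := by gcongr
      refine h3.trans ?_
      have h4 : (p + q) / p * ‖X ω‖ ^ 2 + (p + q) / q * ‖Y ω‖ ^ 2 - (‖X ω‖ + ‖Y ω‖) ^ 2 =
          (q * ‖X ω‖ - p * ‖Y ω‖) ^ 2 / (p * q) := by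
        field_simp
        ring
      have h5 : 0 ≤ (q * ‖X ω‖ - p * ‖Y ω‖) ^ 2 / (p * q) := by positivity
      linarith
    have h6 := integral_mono ((hX.add hY).integrable_norm_pow two_ne_zero)
      ((hiX.const_mul ((p + q) / p)).add (hiY.const_mul ((p + q) / q))) hpt
    refine h6.trans ?_
    simp only [Pi.add_apply]
    rw [integral_add (hiX.const_mul _) (hiY.const_mul _), integral_const_mul, integral_const_mul]
    calc _ ≤ (p + q) / p * p ^ 2 + (p + q) / q * q ^ 2 := by gcongr
      _ = (p + q) ^ 2 := by field_simp
  -- The weights need `p` and `q` positive. Both are enlarged by `κ > 0`, and `κ` tends to `0`.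
  have hlim : Filter.Tendsto (fun κ : ℝ => (p + κ + (q + κ)) ^ 2) (nhdsWithin 0 (Set.Ioi 0))
      (nhds ((p + q) ^ 2)) := by
    have : Continuous fun κ : ℝ => (p + κ + (q + κ)) ^ 2 := by fun_prop
    simpa using (this.tendsto 0).mono_left nhdsWithin_le_nhds
  refine ge_of_tendsto hlim ?_
  filter_upwards [self_mem_nhdsWithin] with κ (hκ : 0 < κ)
  refine hpos _ _ (by linarith) (by linarith) (h1.trans ?_) (h2.trans ?_) <;> gcongr <;> linarith

end SecondMoments

/-! ### Moments of the noise -/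

lemma memLp_gaussian_smul (d : ℕ) (s : ℝ) :
    MemLp id 2 ((stdGaussian (Vec d)).map fun v => s • v) := by
  rw [memLp_map_measure_iff (by fun_prop) (by fun_prop)]
  exact (IsGaussian.memLp_two_id (μ := stdGaussian (Vec d))).const_smul s

lemma integral_gaussian_smul (d : ℕ) (s : ℝ) :
    ∫ v, v ∂((stdGaussian (Vec d)).map fun v => s • v) = 0 := by
  rw [integral_map (by fun_prop) (by fun_prop), integral_smul, integral_id_stdGaussian, smul_zero]

lemma integral_norm_sq_gaussian_smul (d : ℕ) (s : ℝ) :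
    ∫ v, ‖v‖ ^ 2 ∂((stdGaussian (Vec d)).map fun v => s • v) = d * s ^ 2 := by
  have hm : Measurable fun y : Fin d → ℝ => s • (WithLp.toLp 2 y : Vec d) := by fun_prop
  rw [map_stdGaussian_smul, integral_map hm.aemeasurable (by fun_prop)]
  have h1 : ∀ y : Fin d → ℝ, ‖s • (WithLp.toLp 2 y : Vec d)‖ ^ 2 = ∑ i, s ^ 2 * y i ^ 2 := by
    intro y
    rw [norm_smul, mul_pow, EuclideanSpace.real_norm_sq_eq, Finset.mul_sum]
    simp
  have hsq : Integrable (fun y : ℝ => y ^ 2) (gaussianReal 0 1) :=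
    (IsGaussian.memLp_two_id (μ := gaussianReal 0 1)).integrable_sq
  have h2 : ∫ y, y ^ 2 ∂(gaussianReal 0 1) = 1 := by
    have := variance_id_gaussianReal (μ := 0) (v := 1)
    rw [variance_eq_integral (by fun_prop)] at this
    simpa using this
  simp only [h1]
  rw [integral_finsetSum]
  · have h3 : ∀ i : Fin d, ∫ y : Fin d → ℝ, s ^ 2 * y i ^ 2 ∂(Measure.pi fun _ => gaussianReal 0 1)
        = s ^ 2 := fun i => by
      rw [integral_const_mul, integral_comp_eval (μ := fun _ : Fin d => gaussianReal 0 1) (i := i)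
        (f := fun y : ℝ => y ^ 2) (by fun_prop), h2, mul_one]
    simp [h3]
  · intro i _
    exact (integrable_comp_eval (μ := fun _ : Fin d => gaussianReal 0 1) (i := i)
      (f := fun y : ℝ => y ^ 2) hsq).const_mul _


/-! ### The expected losses -/

/-- Convexity bounds the slopes on the segment from `x` to `y` by `f y - f x`, and they tend to the
directional derivative. Only the gradient within `K` is involved, so `K` may have empty interior. -/
lemma inner_gradient_le_sub {d : ℕ} {K : Set (Vec d)} {f : Vec d → ℝ} {x v y : Vec d}
    (hf : ConvexOn ℝ K f) (hx : x ∈ K) (hy : y ∈ K) (hg : HasGradientWithinAt f v K x) :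
    inner ℝ v (y - x) ≤ f y - f x := by
  set γ : ℝ → Vec d := fun r => x + r • (y - x) with hγ
  have hγK : Set.MapsTo γ (Set.Icc 0 1) K := fun r hr =>
    hf.1.add_smul_sub_mem hx hy hr
  have hγd : HasDerivWithinAt γ (y - x) (Set.Icc 0 1) 0 := by
    have := ((hasDerivAt_id (0 : ℝ)).smul_const (y - x)).const_add x
    simpa [hγ] using this.hasDerivWithinAt
  have hγ0 : γ 0 = x := by simp [hγ]
  have hd : HasDerivWithinAt (f ∘ γ) (inner ℝ v (y - x)) (Set.Icc 0 1) 0 := by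
    have h := hg.hasFDerivWithinAt
    rw [← hγ0] at h
    simpa using h.comp_hasDerivWithinAt (0 : ℝ) hγd hγK
  have hslope := hasDerivWithinAt_iff_tendsto_slope.1 hd
  have hne : (nhdsWithin (0 : ℝ) (Set.Icc 0 1 \ {0})).NeBot := by
    have : Set.Icc (0 : ℝ) 1 \ {0} = Set.Ioc 0 1 := Set.Icc_sdiff_left
    rw [this]
    exact left_nhdsWithin_Ioc_neBot zero_lt_one
  refine le_of_tendsto hslope ?_
  filter_upwards [self_mem_nhdsWithin] with r hr
  obtain ⟨⟨hr0, hr1⟩, hr2⟩ := hr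
  have hrpos : 0 < r := lt_of_le_of_ne hr0 (Ne.symm hr2)
  have hc := hf.2 hx hy (sub_nonneg.2 hr1) hr0 (by ring)
  have hpt : (1 - r) • x + r • y = γ r := by simp only [hγ]; module
  rw [hpt] at hc
  rw [slope_def_field, Function.comp, Function.comp, hγ0, sub_zero, div_le_iff₀ hrpos]
  simp only [smul_eq_mul] at hc
  linarith

section ExpLoss

variable {d : ℕ} {K : Set (Vec d)} {Z : Type*} [MeasurableSpace Z] {μ : Measure Z}
  [IsProbabilityMeasure μ] {f : Vec d → Z → ℝ} {g : Vec d → Z → Vec d} {G L σ σL : ℝ}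

lemma IsSampleLaw.memLp_grad (hD : IsSampleLaw K f g σ σL μ) (hf : IsSmoothLoss K f g G L)
    (hconv : Convex ℝ K) (hG : 0 ≤ G) {x : Vec d} (hx : x ∈ K) : MemLp (g x) 2 μ :=
  MemLp.of_bound (hD.measurable_grad x hx).aestronglyMeasurable G
    (ae_of_all _ fun z => hf.norm_grad_le' hconv hG z hx)

lemma IsSampleLaw.integrable_grad (hD : IsSampleLaw K f g σ σL μ) (hf : IsSmoothLoss K f g G L)
    (hconv : Convex ℝ K) (hG : 0 ≤ G) {x : Vec d} (hx : x ∈ K) : Integrable (g x) μ :=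
  (hD.memLp_grad hf hconv hG hx).integrable one_le_two

lemma IsSampleLaw.norm_expGrad_le (hf : IsSmoothLoss K f g G L)
    (hconv : Convex ℝ K) (hG : 0 ≤ G) {x : Vec d} (hx : x ∈ K) : ‖expGrad g μ x‖ ≤ G := by
  unfold expGrad
  simpa using norm_integral_le_of_norm_le_const (μ := μ)
    (ae_of_all _ fun z => hf.norm_grad_le' hconv hG z hx)

lemma IsSampleLaw.norm_expGrad_sub_le (hD : IsSampleLaw K f g σ σL μ)
    (hf : IsSmoothLoss K f g G L) (hconv : Convex ℝ K) (hG : 0 ≤ G) {x y : Vec d} (hx : x ∈ K)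
    (hy : y ∈ K) : ‖expGrad g μ x - expGrad g μ y‖ ≤ L * ‖x - y‖ := by
  unfold expGrad
  rw [← integral_sub (hD.integrable_grad hf hconv hG hx) (hD.integrable_grad hf hconv hG hy)]
  simpa using norm_integral_le_of_norm_le_const (μ := μ)
    (ae_of_all _ fun z => hf.smooth z x hx y hy)

lemma IsSampleLaw.abs_expLoss_sub_le (hD : IsSampleLaw K f g σ σL μ)
    (hf : IsSmoothLoss K f g G L) {x y : Vec d} (hx : x ∈ K) (hy : y ∈ K) :
    |expLoss f μ x - expLoss f μ y| ≤ G * ‖x - y‖ := by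
  unfold expLoss
  rw [← integral_sub (hD.integrable_loss x hx) (hD.integrable_loss y hy)]
  simpa using norm_integral_le_of_norm_le_const (μ := μ)
    (ae_of_all _ fun z => (Real.norm_eq_abs _).trans_le (hf.lipschitz z x hx y hy))

/-- The inequality holds for almost every sample and is then integrated, so no differentiation under
the integral is needed. -/
lemma IsSampleLaw.inner_expGrad_le (hD : IsSampleLaw K f g σ σL μ)
    (hf : IsSmoothLoss K f g G L) (hconv : Convex ℝ K) (hG : 0 ≤ G) {x y : Vec d} (hx : x ∈ K)
    (hy : y ∈ K) : inner ℝ (expGrad g μ x) (y - x) ≤ expLoss f μ y - expLoss f μ x := by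
  unfold expLoss expGrad
  have hg := hD.integrable_grad hf hconv hG hx
  rw [← integral_sub (hD.integrable_loss y hy) (hD.integrable_loss x hx), real_inner_comm,
    ← integral_inner hg]
  refine integral_mono_ae (hg.const_inner _)
    ((hD.integrable_loss y hy).sub (hD.integrable_loss x hx)) ?_
  filter_upwards [hD.convex] with z hz
  rw [real_inner_comm]
  exact inner_gradient_le_sub hz hx hy (hf.hasGradient z x hx)

end ExpLoss

section JointLoss

variable {d M : ℕ} {K : Set (Vec d)} {Z : Fin M → Type*} [∀ i, MeasurableSpace (Z i)]
  {f : ∀ i, Vec d → Z i → ℝ} {g : ∀ i, Vec d → Z i → Vec d} {D : ∀ i, Measure (Z i)}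
  [∀ i, IsProbabilityMeasure (D i)] {G L σ σL : ℝ}

/-- The gradient of the joint objective. -/
def jointGrad (g : ∀ i, Vec d → Z i → Vec d) (D : ∀ i, Measure (Z i)) (x : Vec d) : Vec d :=
  (1 / (M : ℝ)) • ∑ i, expGrad (g i) (D i) x

lemma norm_average_le {E : Type*} [NormedAddCommGroup E] [NormedSpace ℝ E] (hM : 1 ≤ M)
    {v : Fin M → E} {c : ℝ} (hv : ∀ i, ‖v i‖ ≤ c) : ‖(1 / (M : ℝ)) • ∑ i, v i‖ ≤ c := by
  have hM0 : (0 : ℝ) < M := by exact_mod_cast hM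
  rw [norm_smul, Real.norm_of_nonneg (by positivity), one_div, inv_mul_le_iff₀ hM0]
  simpa using norm_sum_le_of_le Finset.univ fun i _ => hv i

lemma norm_jointGrad_le (hM : 1 ≤ M) (hf : ∀ i, IsSmoothLoss K (f i) (g i) G L)
    (hconv : Convex ℝ K) (hG : 0 ≤ G) {x : Vec d} (hx : x ∈ K) : ‖jointGrad g D x‖ ≤ G :=
  norm_average_le hM fun i => IsSampleLaw.norm_expGrad_le (hf i) hconv hG hx

lemma norm_jointGrad_sub_le (hM : 1 ≤ M) (hf : ∀ i, IsSmoothLoss K (f i) (g i) G L)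
    (hD : ∀ i, IsSampleLaw K (f i) (g i) σ σL (D i)) (hconv : Convex ℝ K) (hG : 0 ≤ G)
    {x y : Vec d} (hx : x ∈ K) (hy : y ∈ K) :
    ‖jointGrad g D x - jointGrad g D y‖ ≤ L * ‖x - y‖ := by
  unfold jointGrad
  rw [← smul_sub, ← Finset.sum_sub_distrib]
  exact norm_average_le hM fun i => (hD i).norm_expGrad_sub_le (hf i) hconv hG hx hy

lemma abs_jointLoss_sub_le (hM : 1 ≤ M) (hf : ∀ i, IsSmoothLoss K (f i) (g i) G L)
    (hD : ∀ i, IsSampleLaw K (f i) (g i) σ σL (D i)) {x y : Vec d} (hx : x ∈ K) (hy : y ∈ K) :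
    |jointLoss f D x - jointLoss f D y| ≤ G * ‖x - y‖ := by
  unfold jointLoss
  rw [← mul_sub, ← Finset.sum_sub_distrib]
  exact norm_average_le hM fun i =>
    (Real.norm_eq_abs _).trans_le ((hD i).abs_expLoss_sub_le (hf i) hx hy)

lemma inner_jointGrad_le (hf : ∀ i, IsSmoothLoss K (f i) (g i) G L)
    (hD : ∀ i, IsSampleLaw K (f i) (g i) σ σL (D i)) (hconv : Convex ℝ K) (hG : 0 ≤ G)
    {x y : Vec d} (hx : x ∈ K) (hy : y ∈ K) :
    inner ℝ (jointGrad g D x) (y - x) ≤ jointLoss f D y - jointLoss f D x := by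
  unfold jointLoss jointGrad
  rw [← mul_sub, ← Finset.sum_sub_distrib, real_inner_smul_left, sum_inner]
  gcongr with i
  exact (hD i).inner_expGrad_le (hf i) hconv hG hx hy

end JointLoss

/-! ### The progress of one round -/

/-- The three-point inequality of a projected step. The term `-‖w' - w‖ ^ 2` is kept since it later
absorbs the effect of the noise on `w'`. -/
lemma projPoint_progress {d : ℕ} {K : Set (Vec d)} (hconv : Convex ℝ K) (hK : IsCompact K)
    {w p y : Vec d} (hy : y ∈ K) :
    2 * inner ℝ p (Timed.projPoint K (w - p) - y) ≤
      ‖w - y‖ ^ 2 - ‖Timed.projPoint K (w - p) - y‖ ^ 2 - ‖Timed.projPoint K (w - p) - w‖ ^ 2 := by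
  set w' := Timed.projPoint K (w - p)
  have h := inner_sub_projPoint_le hconv hK ⟨y, hy⟩ (w - p) hy
  change inner ℝ (w - p - w') (y - w') ≤ 0 at h
  have h1 : ‖w - y‖ ^ 2 = ‖w' - y‖ ^ 2 + ‖w' - w‖ ^ 2 - 2 * inner ℝ (w' - w) (w' - y) := by
    have : w - y = (w' - y) - (w' - w) := by abel
    rw [this, norm_sub_sq_real, real_inner_comm]
    ring
  have h2 : inner ℝ (w - p - w') (y - w') =
      inner ℝ (w' - w) (w' - y) + inner ℝ p (w' - y) := by
    rw [← inner_add_left, ← inner_neg_neg]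
    congr 1 <;> abel
  linarith

/-- The progress of one round with gradient error `e` and noise `N`. -/
lemma round_progress {d : ℕ} {K : Set (Vec d)} (hconv : Convex ℝ K) (hK : IsCompact K)
    {F : Vec d → ℝ} {H : Vec d → Vec d} {B G L η : ℝ} (hL : 0 ≤ L) (hη : 0 < η)
    (hdiam : ∀ x ∈ K, ∀ y ∈ K, ‖x - y‖ ≤ B)
    (hF : ∀ x ∈ K, ∀ y ∈ K, inner ℝ (H x) (y - x) ≤ F y - F x)
    (hHG : ∀ x ∈ K, ‖H x‖ ≤ G) (hHL : ∀ x ∈ K, ∀ y ∈ K, ‖H x - H y‖ ≤ L * ‖x - y‖)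
    (t : ℕ) {w x w' x' e N y : Vec d} (hx : x ∈ K) (hx'K : x' ∈ K) (hy : y ∈ K)
    (hw' : w' = Timed.projPoint K (w - η • (((t : ℝ) + 1) • H x + e + N)))
    (hx' : x' = (impWeightSum (t + 1) / impWeightSum (t + 2)) • x +
      (impWeight (t + 2) / impWeightSum (t + 2)) • w') :
    impWeightSum (t + 2) * (F x' - F y) + ‖w' - y‖ ^ 2 / (2 * η) ≤
      impWeightSum (t + 1) * (F x - F y) + ‖w - y‖ ^ 2 / (2 * η) + (G * B + 2 * L * B ^ 2) +
        (B * ‖e‖ - inner ℝ N (w - y) + η / 2 * ‖N‖ ^ 2) := by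
  have hw'K : w' ∈ K := hw' ▸ projPoint_mem hK ⟨y, hy⟩ _
  have hB : 0 ≤ B := (norm_nonneg _).trans (hdiam _ hx _ hx)
  set γ : ℝ := 2 / ((t : ℝ) + 3) with hγ
  set A : ℝ := impWeightSum (t + 2) with hA
  have hA_eq : A = ((t : ℝ) + 2) * (t + 3) / 2 := by
    rw [hA, impWeightSum_eq]; push_cast; ring
  have hA1 : impWeightSum (t + 1) = A * (1 - γ) := by
    rw [hA_eq, hγ, impWeightSum_eq]; push_cast; field_simp; ring
  have hAγ : A * γ = (t : ℝ) + 2 := by rw [hA_eq, hγ]; field_simp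
  have hApos : 0 < A := by rw [hA_eq]; positivity
  have hxx : x' - x = γ • (w' - x) := by
    rw [hx']
    have e1 : impWeightSum (t + 1) / A = 1 - γ := by
      rw [hA1]; field_simp
    have e2 : impWeight (t + 2) / A = γ := by
      have : impWeight (t + 2) = A * γ := by rw [hAγ, impWeight]; push_cast; ring
      rw [this]; field_simp
    rw [e1, e2]
    module
  -- smoothness and convexity
  have hγ0 : 0 ≤ γ := by positivity
  have hγt : (t + 2) * γ ≤ 2 := by
    rw [hγ, mul_div_assoc', div_le_iff₀ (by positivity)]; linarith
  -- Convexity at `x'` replaces the descent lemma: the gradient there is exchanged for the one at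
  -- `x` at the cost `L * ‖x' - x‖ ^ 2`.
  have s1 : F x' - F x ≤ inner ℝ (H x) (x' - x) + L * (γ * B) ^ 2 := by
    have h1 := hF x' hx'K x hx
    have h2 : inner ℝ (H x' - H x) (x' - x) ≤ L * ‖x' - x‖ * ‖x' - x‖ :=
      (real_inner_le_norm _ _).trans
        (mul_le_mul_of_nonneg_right (hHL _ hx'K _ hx) (norm_nonneg _))
    have h3 : inner ℝ (H x' - H x) (x' - x) =
        -inner ℝ (H x') (x - x') - inner ℝ (H x) (x' - x) := by
      rw [inner_sub_left, ← inner_neg_right, neg_sub]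
    have h4 : ‖x' - x‖ ≤ γ * B := by
      rw [hxx, norm_smul, Real.norm_of_nonneg hγ0]
      exact mul_le_mul_of_nonneg_left (hdiam _ hw'K _ hx) hγ0
    have h5 : L * ‖x' - x‖ * ‖x' - x‖ ≤ L * (γ * B) ^ 2 := by
      rw [mul_assoc, ← sq]
      gcongr
    linarith
  have s2 : inner ℝ (H x) (x' - x) ≤ γ * inner ℝ (H x) (w' - y) + γ * (F y - F x) := by
    rw [hxx, real_inner_smul_right, ← mul_add]
    refine mul_le_mul_of_nonneg_left ?_ hγ0
    have : w' - x = (w' - y) + (y - x) := by abel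
    rw [this, inner_add_right]
    have := hF x hx y hy
    linarith
  have s3 : A * (F x' - F y) ≤ impWeightSum (t + 1) * (F x - F y) +
      ((t : ℝ) + 2) * inner ℝ (H x) (w' - y) + 2 * L * B ^ 2 := by
    have h1 := mul_le_mul_of_nonneg_left (s1.trans (add_le_add_left s2 _)) hApos.le
    have h2 : A * (L * (γ * B) ^ 2) ≤ 2 * L * B ^ 2 := by
      calc A * (L * (γ * B) ^ 2) = (A * γ) * γ * (L * B ^ 2) := by ring
        _ ≤ 2 * (L * B ^ 2) := by rw [hAγ]; gcongr
        _ = 2 * L * B ^ 2 := by ring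
    have h3 : A * (γ * inner ℝ (H x) (w' - y)) = ((t : ℝ) + 2) * inner ℝ (H x) (w' - y) := by
      rw [← mul_assoc, hAγ]
    rw [hA1]
    nlinarith
  -- the projected step
  have s4 := projPoint_progress hconv hK (w := w) (p := η • (((t : ℝ) + 1) • H x + e + N)) hy
  rw [← hw', real_inner_smul_left, inner_add_left, inner_add_left, real_inner_smul_left] at s4
  -- The averaging uses the weight `t + 2` but the step only `t + 1`. One copy of this inner product
  -- is left over and costs `G * B`.
  have s5 : inner ℝ (H x) (w' - y) ≤ G * B :=
    (real_inner_le_norm _ _).trans (mul_le_mul (hHG x hx) (hdiam _ hw'K _ hy) (norm_nonneg _)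
      ((norm_nonneg _).trans (hHG x hx)))
  have s6 : -inner ℝ e (w' - y) ≤ B * ‖e‖ := by
    rw [← inner_neg_left]
    refine (real_inner_le_norm _ _).trans ?_
    rw [norm_neg, mul_comm]
    exact mul_le_mul_of_nonneg_right (hdiam _ hw'K _ hy) (norm_nonneg _)
  -- The noise is paired with `w`, which does not depend on it, so that this term has mean zero
  -- later. The passage from `w'` to `w` is paid by Young's inequality.
  have s7 : -inner ℝ N (w' - y) ≤
      -inner ℝ N (w - y) + η / 2 * ‖N‖ ^ 2 + ‖w' - w‖ ^ 2 / (2 * η) := by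
    have h1 : inner ℝ N (w' - y) = inner ℝ N (w - y) + inner ℝ N (w' - w) := by
      rw [← inner_add_right]; congr 1; abel
    have h2 : -(‖N‖ * ‖w' - w‖) ≤ inner ℝ N (w' - w) := by
      have := abs_le.1 (abs_real_inner_le_norm N (w' - w))
      exact this.1
    have h3 : η / 2 * ‖N‖ ^ 2 + ‖w' - w‖ ^ 2 / (2 * η) - ‖N‖ * ‖w' - w‖ =
        (η * ‖N‖ - ‖w' - w‖) ^ 2 / (2 * η) := by
      field_simp
      ring
    have h4 : 0 ≤ (η * ‖N‖ - ‖w' - w‖) ^ 2 / (2 * η) := by positivity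
    linarith
  have s8 : ((t : ℝ) + 1) * inner ℝ (H x) (w' - y) + inner ℝ e (w' - y) + inner ℝ N (w' - y) ≤
      ‖w - y‖ ^ 2 / (2 * η) - ‖w' - y‖ ^ 2 / (2 * η) - ‖w' - w‖ ^ 2 / (2 * η) := by
    rw [← sub_div, ← sub_div, le_div_iff₀ (by positivity)]
    linarith
  linarith


/-! ### The gradient errors -/

/-- The deviation of a stochastic gradient from its expectation. -/
def centredGrad {d : ℕ} {Z : Type*} [MeasurableSpace Z] (g : Vec d → Z → Vec d) (μ : Measure Z)
    (x : Vec d) (z : Z) : Vec d :=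
  g x z - expGrad g μ x

lemma momIncr_centredGrad {d M : ℕ} {Z : Type*} [MeasurableSpace Z] {μ : Measure Z}
    {g : Vec d → Z → Vec d} (t : ℕ) (s : State d M) (z : Z) :
    momIncr (centredGrad g μ) t s z = momIncr g t s z -
      (expGrad g μ s.x + (t : ℝ) • (expGrad g μ s.x - expGrad g μ s.xprev)) := by
  unfold momIncr centredGrad
  module

section CentredGrad

variable {d M : ℕ} {K : Set (Vec d)} {Z : Type*} [MeasurableSpace Z] {μ : Measure Z}
  [IsProbabilityMeasure μ] {f : Vec d → Z → ℝ} {g : Vec d → Z → Vec d} {G L σ σL : ℝ}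

lemma IsSampleLaw.memLp_centredGrad (hD : IsSampleLaw K f g σ σL μ) (hf : IsSmoothLoss K f g G L)
    (hconv : Convex ℝ K) (hG : 0 ≤ G) {x : Vec d} (hx : x ∈ K) : MemLp (centredGrad g μ x) 2 μ :=
  (hD.memLp_grad hf hconv hG hx).sub (memLp_const _)

lemma IsSampleLaw.integral_centredGrad (hD : IsSampleLaw K f g σ σL μ)
    (hf : IsSmoothLoss K f g G L) (hconv : Convex ℝ K) (hG : 0 ≤ G) {x : Vec d} (hx : x ∈ K) :
    ∫ z, centredGrad g μ x z ∂μ = 0 := by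
  unfold centredGrad
  rw [integral_sub (hD.integrable_grad hf hconv hG hx) (integrable_const _)]
  simp [expGrad]

lemma IsSampleLaw.memLp_momIncr (hD : IsSampleLaw K f g σ σL μ) (hf : IsSmoothLoss K f g G L)
    (hconv : Convex ℝ K) (hG : 0 ≤ G) (t : ℕ) {s : State d M} (hx : s.x ∈ K)
    (hxp : s.xprev ∈ K) : MemLp (momIncr (centredGrad g μ) t s) 2 μ :=
  (hD.memLp_centredGrad hf hconv hG hx).add
    (((hD.memLp_centredGrad hf hconv hG hx).sub
      (hD.memLp_centredGrad hf hconv hG hxp)).const_smul (t : ℝ))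

lemma IsSampleLaw.integral_momIncr (hD : IsSampleLaw K f g σ σL μ) (hf : IsSmoothLoss K f g G L)
    (hconv : Convex ℝ K) (hG : 0 ≤ G) (t : ℕ) {s : State d M} (hx : s.x ∈ K)
    (hxp : s.xprev ∈ K) : ∫ z, momIncr (centredGrad g μ) t s z ∂μ = 0 := by
  have h1 := (hD.memLp_centredGrad hf hconv hG hx).integrable one_le_two
  have h2 := (hD.memLp_centredGrad hf hconv hG hxp).integrable one_le_two
  unfold momIncr
  have h3 : Integrable
      (fun z => (t : ℝ) • (centredGrad g μ s.x z - centredGrad g μ s.xprev z)) μ :=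
    (h1.sub h2).smul (t : ℝ)
  rw [integral_add h1 h3, integral_smul, integral_sub h1 h2,
    hD.integral_centredGrad hf hconv hG hx, hD.integral_centredGrad hf hconv hG hxp]
  simp

/-- The `L²` counterpart of `norm_momIncr_le`, with `σ` and `σL` in place of `G` and `L`. -/
lemma IsSampleLaw.integral_norm_sq_momIncr_le (hD : IsSampleLaw K f g σ σL μ)
    (hf : IsSmoothLoss K f g G L) (hconv : Convex ℝ K) (hG : 0 ≤ G) (hσ : 0 ≤ σ) (hσL : 0 ≤ σL)
    {B : ℝ} (hB : 0 ≤ B) (t : ℕ) {s : State d M} (hx : s.x ∈ K) (hxp : s.xprev ∈ K)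
    (hs : t * ‖s.x - s.xprev‖ ≤ 2 * B) :
    ∫ z, ‖momIncr (centredGrad g μ) t s z‖ ^ 2 ∂μ ≤ totalDev σ σL B ^ 2 := by
  have h1 := hD.memLp_centredGrad hf hconv hG hx
  have h2 := hD.memLp_centredGrad hf hconv hG hxp
  refine integral_norm_add_sq_le h1 ((h1.sub h2).const_smul (t : ℝ)) hσ (by positivity)
    (hD.variance_le _ hx) ?_
  have h3 := hD.smoothness_variance_le _ hx _ hxp
  have h4 : ∀ z, ‖((t : ℝ) • (centredGrad g μ s.x - centredGrad g μ s.xprev)) z‖ ^ 2 =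
      (t : ℝ) ^ 2 * ‖centredGrad g μ s.x z - centredGrad g μ s.xprev z‖ ^ 2 := fun z => by
    rw [Pi.smul_apply, Pi.sub_apply, norm_smul, mul_pow, Real.norm_of_nonneg (Nat.cast_nonneg t)]
  simp only [h4]
  rw [integral_const_mul]
  calc (t : ℝ) ^ 2 * ∫ z, ‖centredGrad g μ s.x z - centredGrad g μ s.xprev z‖ ^ 2 ∂μ
      ≤ (t : ℝ) ^ 2 * (σL ^ 2 * ‖s.x - s.xprev‖ ^ 2) := by gcongr; exact h3
    _ = σL ^ 2 * (t * ‖s.x - s.xprev‖) ^ 2 := by ring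
    _ ≤ σL ^ 2 * (2 * B) ^ 2 := by gcongr
    _ = (2 * σL * B) ^ 2 := by ring

end CentredGrad

/-- The data of the learning problem, with all assumptions on the losses and the samples. -/
structure IsProblem {d M : ℕ} {Z : Fin M → Type*} [∀ i, MeasurableSpace (Z i)] (K : Set (Vec d))
    (x₁ : Vec d) (f : ∀ i, Vec d → Z i → ℝ) (g : ∀ i, Vec d → Z i → Vec d)
    (D : ∀ i, Measure (Z i)) (B G L σ σL : ℝ) : Prop where
  one_le : 1 ≤ M
  convex : Convex ℝ K
  compact : IsCompact K
  mem : x₁ ∈ K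
  diam : ∀ x ∈ K, ∀ y ∈ K, ‖x - y‖ ≤ B
  G_nonneg : 0 ≤ G
  L_nonneg : 0 ≤ L
  σ_nonneg : 0 ≤ σ
  σL_nonneg : 0 ≤ σL
  smooth : ∀ i, IsSmoothLoss K (f i) (g i) G L
  law : ∀ i, IsSampleLaw K (f i) (g i) σ σL (D i)

/-- The law of the samples and the noise of a run. -/
def runLaw {M : ℕ} {Z : Fin M → Type*} [∀ i, MeasurableSpace (Z i)] (d n : ℕ)
    (D : ∀ i, Measure (Z i)) (s : ℝ) : Measure (Datasets Z n × Noise d M n) :=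
  (dataLaw n D).prod (noiseLaw d M n s)

/-! ### Resampling a single sample or noise vector of a run -/

section Replace

variable {d M n : ℕ} {Z : Fin M → Type*} {K : Set (Vec d)} {x₁ : Vec d}
  {g : ∀ i, Vec d → Z i → Vec d} {η : ℝ}

/-- Replace the sample of machine `k.2` in round `k.1 + 1`. -/
def replaceSample (k : Fin n × Fin M) (p : (Datasets Z n × Noise d M n) × Z k.2) :
    Datasets Z n × Noise d M n :=
  (Function.update p.1.1 k.2 (Function.update (p.1.1 k.2) k.1 p.2), p.1.2)

/-- Replace the noise of machine `k.2` in round `k.1 + 1`. -/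
def replaceNoise (k : Fin n × Fin M) (p : (Datasets Z n × Noise d M n) × Vec d) :
    Datasets Z n × Noise d M n :=
  (p.1.1, Function.update p.1.2 k.1 (Function.update (p.1.2 k.1) k.2 p.2))

/-- The state before round `k.1 + 1` has not seen the sample of that round; this is the independence
used below. -/
lemma stateAt_replaceSample (k : Fin n × Fin M) (ω : Datasets Z n × Noise d M n) (z : Z k.2)
    {t : ℕ} (ht : t ≤ n) (htk : t ≤ k.1) :
    stateAt K g η x₁ (replaceSample k (ω, z)).1 (replaceSample k (ω, z)).2 t ht =
      stateAt K g η x₁ ω.1 ω.2 t ht := by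
  refine stateAt_congr ht (fun r hr i => ?_) fun _ _ => rfl
  have hne : r ≠ k.1 := fun h => by subst h; omega
  rcases eq_or_ne i k.2 with rfl | hi
  · simp [replaceSample, hne]
  · simp [replaceSample, hi]

lemma stateAt_replaceNoise (k : Fin n × Fin M) (ω : Datasets Z n × Noise d M n) (y : Vec d)
    {t : ℕ} (ht : t ≤ n) (htk : t ≤ k.1) :
    stateAt K g η x₁ (replaceNoise k (ω, y)).1 (replaceNoise k (ω, y)).2 t ht =
      stateAt K g η x₁ ω.1 ω.2 t ht := by
  refine stateAt_congr ht (fun _ _ _ => rfl) fun r hr => ?_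
  have hne : r ≠ k.1 := fun h => by subst h; omega
  simp [replaceNoise, hne]

end Replace

section GradError

variable {d M n : ℕ} {Z : Fin M → Type*} [∀ i, MeasurableSpace (Z i)] {K : Set (Vec d)}
  {x₁ : Vec d} {g : ∀ i, Vec d → Z i → Vec d} {D : ∀ i, Measure (Z i)} {η : ℝ}

/-- The contribution of the sample of machine `k.2` in round `k.1 + 1` to the error of the weighted
momentum. -/
def sampleError (K : Set (Vec d)) (g : ∀ i, Vec d → Z i → Vec d) (η : ℝ) (x₁ : Vec d)
    (D : ∀ i, Measure (Z i)) (k : Fin n × Fin M) (ω : Datasets Z n × Noise d M n) : Vec d :=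
  momIncr (centredGrad (g k.2) (D k.2)) k.1 (stateAt K g η x₁ ω.1 ω.2 k.1 k.1.2.le) (ω.1 k.2 k.1)

/-- The expected increment is `(t + 1) ∇f_i(x) - t ∇f_i(xprev)`, which telescopes. So the momentum
estimates the gradient at the latest query point, with no bias from the earlier ones. -/
lemma impWeight_smul_mom_eq_sum (ω : Datasets Z n × Noise d M n) (i : Fin M) {t : ℕ}
    (ht : t ≤ n) : impWeight t • (stateAt K g η x₁ ω.1 ω.2 t ht).mom i =
      ∑ r : Fin n with r.1 < t, sampleError K g η x₁ D (r, i) ω +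
        impWeight t • expGrad (g i) (D i) (stateAt K g η x₁ ω.1 ω.2 t ht).xprev := by
  induction t with
  | zero => simp [impWeight]
  | succ t ih =>
      have hset : (Finset.univ.filter fun r : Fin n => r.1 < t + 1) =
          insert ⟨t, ht⟩ (Finset.univ.filter fun r : Fin n => r.1 < t) := by
        ext r
        simp only [Finset.mem_filter, Finset.mem_univ, true_and, Finset.mem_insert, Fin.ext_iff]
        omega
      rw [impWeight_smul_mom, ih (by omega), hset, Finset.sum_insert (by simp),
        stateAt_succ_xprev, sampleError, momIncr_centredGrad]
      simp only [impWeight]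
      push_cast
      module

/-- The average of the errors of the weighted momenta in round `t + 1`. -/
def gradError (K : Set (Vec d)) (g : ∀ i, Vec d → Z i → Vec d) (η : ℝ) (x₁ : Vec d)
    (D : ∀ i, Measure (Z i)) (t : ℕ) (ω : Datasets Z n × Noise d M n) : Vec d :=
  (1 / (M : ℝ)) • ∑ k : Fin n × Fin M with k.1.1 < t + 1, sampleError K g η x₁ D k ω

/-- The average of the noise of round `t + 1`. -/
def avgNoise (t : Fin n) (ω : Datasets Z n × Noise d M n) : Vec d :=
  (1 / (M : ℝ)) • ∑ i, ω.2 t i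

lemma average_msg (ω : Datasets Z n × Noise d M n) {t : ℕ} (ht : t < n) :
    (1 / (M : ℝ)) • ∑ i, (stateAt K g η x₁ ω.1 ω.2 (t + 1) ht).msg i =
      ((t : ℝ) + 1) • jointGrad g D (stateAt K g η x₁ ω.1 ω.2 t ht.le).x +
        gradError K g η x₁ D t ω + avgNoise ⟨t, ht⟩ ω := by
  have hset : (Finset.univ.filter fun k : Fin n × Fin M => k.1.1 < t + 1) =
      (Finset.univ.filter fun r : Fin n => r.1 < t + 1) ×ˢ Finset.univ := by
    ext k; simp
  simp only [stateAt_succ_msg]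
  rw [Finset.sum_add_distrib, smul_add]
  simp only [impWeight_smul_mom_eq_sum (D := D)]
  rw [gradError, avgNoise, hset, Finset.sum_product_right, Finset.sum_add_distrib, smul_add,
    jointGrad, stateAt_succ_xprev, ← Finset.smul_sum, smul_comm ((t : ℝ) + 1)]
  simp only [impWeight]
  push_cast
  abel

end GradError

section RunLaw

variable {d M n : ℕ} {Z : Fin M → Type*} [∀ i, MeasurableSpace (Z i)] {D : ∀ i, Measure (Z i)}
  [∀ i, IsProbabilityMeasure (D i)] {s : ℝ}

instance (s : ℝ) : IsProbabilityMeasure (noiseLaw d M n s) := by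
  unfold noiseLaw; infer_instance

instance : IsProbabilityMeasure (dataLaw n D) := by
  unfold dataLaw; infer_instance

instance : IsProbabilityMeasure (runLaw d n D s) := by
  unfold runLaw; infer_instance

lemma measurePreserving_replaceSample (k : Fin n × Fin M) :
    MeasurePreserving (replaceSample k) ((runLaw d n D s).prod (D k.2)) (runLaw d n D s) :=
  measurePreserving_prod_left (P := dataLaw n D) (Q := noiseLaw d M n s)
    (T := fun p => Function.update p.1 k.2 (Function.update (p.1 k.2) k.1 p.2))
    (measurePreserving_update_comp (fun i => Measure.pi fun _ : Fin n => D i) k.2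
      (R := fun p => Function.update p.1 k.1 p.2)
      (measurePreserving_update (fun _ : Fin n => D k.2) k.1))

lemma measurePreserving_replaceNoise (k : Fin n × Fin M) :
    MeasurePreserving (replaceNoise k)
      ((runLaw d n D s).prod ((stdGaussian (Vec d)).map fun v => s • v)) (runLaw d n D s) :=
  measurePreserving_prod_right (P := dataLaw n D) (Q := noiseLaw d M n s)
    (T := fun p => Function.update p.1 k.1 (Function.update (p.1 k.1) k.2 p.2))
    (measurePreserving_update_comp (fun _ => Measure.pi fun _ : Fin M =>
        (stdGaussian (Vec d)).map fun v => s • v) k.1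
      (R := fun p => Function.update p.1 k.2 p.2)
      (measurePreserving_update (fun _ : Fin M => (stdGaussian (Vec d)).map fun v => s • v) k.2))

lemma measurePreserving_noise (k : Fin n × Fin M) :
    MeasurePreserving (fun ω : Datasets Z n × Noise d M n => ω.2 k.1 k.2) (runLaw d n D s)
      ((stdGaussian (Vec d)).map fun v => s • v) :=
  ((measurePreserving_eval (fun _ : Fin M => (stdGaussian (Vec d)).map fun v => s • v) k.2).comp
    (measurePreserving_eval (fun _ : Fin n => Measure.pi fun _ : Fin M =>
      (stdGaussian (Vec d)).map fun v => s • v) k.1)).comp measurePreserving_snd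

end RunLaw


/-! ### The excess loss -/

namespace IsProblem

variable {d M n : ℕ} {Z : Fin M → Type*} [∀ i, MeasurableSpace (Z i)] {K : Set (Vec d)}
  {x₁ : Vec d} {f : ∀ i, Vec d → Z i → ℝ} {g : ∀ i, Vec d → Z i → Vec d}
  {D : ∀ i, Measure (Z i)} {B G L σ σL η s : ℝ}

lemma B_nonneg (H : IsProblem K x₁ f g D B G L σ σL) : 0 ≤ B :=
  (norm_nonneg _).trans (H.diam _ H.mem _ H.mem)

lemma stateAt_mem (H : IsProblem K x₁ f g D B G L σ σL) (η : ℝ) (ω : Datasets Z n × Noise d M n)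
    {t : ℕ} (ht : t ≤ n) : (stateAt K g η x₁ ω.1 ω.2 t ht).w ∈ K ∧
      (stateAt K g η x₁ ω.1 ω.2 t ht).x ∈ K ∧ (stateAt K g η x₁ ω.1 ω.2 t ht).xprev ∈ K :=
  FedDP.stateAt_mem _ _ H.convex H.compact H.mem ht

lemma measurable_state (H : IsProblem K x₁ f g D B G L σ σL) (η : ℝ) {t : ℕ} (ht : t ≤ n) :
    (Measurable fun ω : Datasets Z n × Noise d M n => (stateAt K g η x₁ ω.1 ω.2 t ht).w) ∧
    (Measurable fun ω : Datasets Z n × Noise d M n => (stateAt K g η x₁ ω.1 ω.2 t ht).x) ∧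
    (Measurable fun ω : Datasets Z n × Noise d M n => (stateAt K g η x₁ ω.1 ω.2 t ht).xprev) := by
  obtain ⟨h1, h2, h3, -⟩ := measurable_stateAt (η := η) H.convex H.compact H.mem
    (fun ω : Datasets Z n × Noise d M n => ω.1) (fun ω => ω.2) measurable_snd
    (fun i t x hx hxK => measurable_comp_of_lipschitz H.L_nonneg (H.smooth i).smooth H.convex
      H.compact (fun ω => ω.1 i t)
      (fun y hy => ((H.law i).measurable_grad y hy).comp
        (f := fun ω : Datasets Z n × Noise d M n => ω.1 i t) (by fun_prop)) x hx hxK) ht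
  exact ⟨h1, h2, h3⟩

lemma sampleError_replaceSample (k : Fin n × Fin M) (ω : Datasets Z n × Noise d M n) (z : Z k.2) :
    sampleError K g η x₁ D k (replaceSample k (ω, z)) = momIncr (centredGrad (g k.2) (D k.2)) k.1
      (stateAt K g η x₁ ω.1 ω.2 k.1 k.1.2.le) z := by
  rw [sampleError, stateAt_replaceSample k ω z _ le_rfl]
  simp [replaceSample]

lemma sampleError_replaceSample_of_ne {k j : Fin n × Fin M} (hjk : j ≠ k) (hle : j.1 ≤ k.1)
    (ω : Datasets Z n × Noise d M n) (z : Z k.2) :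
    sampleError K g η x₁ D j (replaceSample k (ω, z)) = sampleError K g η x₁ D j ω := by
  rw [sampleError, sampleError, stateAt_replaceSample k ω z _ hle]
  congr 1
  obtain ⟨t, i⟩ := j
  obtain ⟨r, l⟩ := k
  rcases eq_or_ne i l with rfl | hi
  · have : t ≠ r := fun h => hjk (by rw [h])
    simp [replaceSample, this]
  · simp [replaceSample, hi]

lemma totalDev_nonneg (H : IsProblem K x₁ f g D B G L σ σL) : 0 ≤ totalDev σ σL B := by
  have := H.σ_nonneg
  have := H.σL_nonneg
  have := H.B_nonneg
  unfold totalDev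
  positivity

lemma M_pos (H : IsProblem K x₁ f g D B G L σ σL) : (0 : ℝ) < M := by
  exact_mod_cast H.one_le

variable [∀ i, IsProbabilityMeasure (D i)]

lemma norm_centredGrad_le (H : IsProblem K x₁ f g D B G L σ σL) (i : Fin M) (z : Z i) {x : Vec d}
    (hx : x ∈ K) : ‖centredGrad (g i) (D i) x z‖ ≤ 2 * G := by
  refine (norm_sub_le _ _).trans ?_
  have h1 := (H.smooth i).norm_grad_le' H.convex H.G_nonneg z hx
  have h2 : ‖expGrad (g i) (D i) x‖ ≤ G :=
    IsSampleLaw.norm_expGrad_le (H.smooth i) H.convex H.G_nonneg hx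
  linarith

lemma measurable_centredGrad (H : IsProblem K x₁ f g D B G L σ σL) (i : Fin M) (t : Fin n)
    (x : Datasets Z n × Noise d M n → Vec d) (hx : Measurable x) (hxK : ∀ ω, x ω ∈ K) :
    Measurable fun ω => centredGrad (g i) (D i) (x ω) (ω.1 i t) := by
  have hL := H.L_nonneg
  refine measurable_comp_of_lipschitz (L := 2 * L) (by positivity) (fun z x hx y hy => ?_) H.convex
    H.compact (fun ω : Datasets Z n × Noise d M n => ω.1 i t) (fun y hy => ?_) x hx hxK
  · have h1 := (H.smooth i).smooth z x hx y hy
    have h2 := (H.law i).norm_expGrad_sub_le (H.smooth i) H.convex H.G_nonneg hx hy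
    have h3 : centredGrad (g i) (D i) x z - centredGrad (g i) (D i) y z =
        (g i x z - g i y z) - (expGrad (g i) (D i) x - expGrad (g i) (D i) y) := by
      unfold centredGrad
      abel
    rw [h3]
    refine (norm_sub_le _ _).trans ?_
    linarith
  · exact (((H.law i).measurable_grad y hy).sub_const _).comp (by fun_prop)

lemma memLp_sampleError (H : IsProblem K x₁ f g D B G L σ σL) (η : ℝ) (k : Fin n × Fin M) :
    MemLp (sampleError K g η x₁ D k) 2 (runLaw d n D s) := by
  obtain ⟨-, hx, hxp⟩ := H.measurable_state η k.1.2.le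
  have hK := fun ω => H.stateAt_mem (n := n) η ω k.1.2.le
  have h1 := H.measurable_centredGrad k.2 k.1 _ hx fun ω => (hK ω).2.1
  have h2 := H.measurable_centredGrad k.2 k.1 _ hxp fun ω => (hK ω).2.2
  have hm : Measurable (sampleError K g η x₁ D k) := h1.add ((h1.sub h2).const_smul (k.1 : ℝ))
  refine MemLp.of_bound hm.aestronglyMeasurable (2 * G + k.1 * (2 * G + 2 * G))
    (ae_of_all _ fun ω => ?_)
  have b1 := H.norm_centredGrad_le k.2 (ω.1 k.2 k.1) (hK ω).2.1
  have b2 := H.norm_centredGrad_le k.2 (ω.1 k.2 k.1) (hK ω).2.2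
  refine (norm_add_le _ _).trans (add_le_add b1 ?_)
  rw [norm_smul, Real.norm_of_nonneg (Nat.cast_nonneg _)]
  gcongr
  exact (norm_sub_le _ _).trans (add_le_add b1 b2)

/-- Martingale differences are orthogonal: resampling the sample of the later round freezes the
other error and gives this one mean zero. In the same round the two samples belong to different
machines, and the argument is unchanged. -/
lemma integral_inner_sampleError (H : IsProblem K x₁ f g D B G L σ σL) (η : ℝ)
    {j k : Fin n × Fin M} (hjk : j ≠ k) :
    ∫ ω, inner ℝ (sampleError K g η x₁ D j ω) (sampleError K g η x₁ D k ω) ∂(runLaw d n D s)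
      = 0 := by
  wlog hle : j.1 ≤ k.1 generalizing j k
  · rw [← this hjk.symm (le_of_not_ge hle)]
    exact integral_congr_ae (ae_of_all _ fun ω => real_inner_comm _ _)
  refine integral_eq_zero_of_resample (measurePreserving_replaceSample k)
    (integrable_inner_of_memLp (H.memLp_sampleError η j) (H.memLp_sampleError η k)) fun ω => ?_
  have hK := H.stateAt_mem (n := n) η ω k.1.2.le
  simp only [sampleError_replaceSample, sampleError_replaceSample_of_ne hjk hle]
  rw [integral_inner, (H.law k.2).integral_momIncr (H.smooth k.2) H.convex H.G_nonneg _ hK.2.1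
    hK.2.2, inner_zero_right]
  exact ((H.law k.2).memLp_momIncr (H.smooth k.2) H.convex H.G_nonneg _ hK.2.1 hK.2.2).integrable
    one_le_two

lemma integral_norm_sq_sampleError_le (H : IsProblem K x₁ f g D B G L σ σL) (η : ℝ)
    (k : Fin n × Fin M) :
    ∫ ω, ‖sampleError K g η x₁ D k ω‖ ^ 2 ∂(runLaw d n D s) ≤ totalDev σ σL B ^ 2 := by
  refine integral_le_of_resample (measurePreserving_replaceSample k)
    ((H.memLp_sampleError η k).integrable_norm_pow two_ne_zero) fun ω => ?_
  have hK := H.stateAt_mem (n := n) η ω k.1.2.le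
  simp only [sampleError_replaceSample]
  exact (H.law k.2).integral_norm_sq_momIncr_le (H.smooth k.2) H.convex H.G_nonneg H.σ_nonneg
    H.σL_nonneg H.B_nonneg _ hK.2.1 hK.2.2
    (norm_x_sub_xprev_le _ _ H.convex H.compact H.mem H.diam k.1.2.le)

lemma memLp_gradError (H : IsProblem K x₁ f g D B G L σ σL) (η : ℝ) (t : ℕ) :
    MemLp (gradError (n := n) K g η x₁ D t) 2 (runLaw d n D s) :=
  (memLp_finsetSum _ fun k _ => H.memLp_sampleError η k).const_smul (1 / (M : ℝ))

lemma integral_norm_gradError_le (H : IsProblem K x₁ f g D B G L σ σL) (η : ℝ) (t : ℕ) :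
    ∫ ω, ‖gradError (n := n) K g η x₁ D t ω‖ ∂(runLaw d n D s) ≤ totalDev σ σL B * √(n / M) := by
  have hM := H.M_pos
  have hdev := H.totalDev_nonneg
  refine integral_norm_le_of_sq (H.memLp_gradError η t) (by positivity) ?_
  have h1 := integral_norm_sq_sum_le (P := runLaw d n D s) (c := totalDev σ σL B ^ 2)
    (Finset.univ.filter fun k : Fin n × Fin M => k.1.1 < t + 1)
    (fun k _ => H.memLp_sampleError η k) (fun k _ => H.integral_norm_sq_sampleError_le η k)
    (fun j _ k _ hjk => H.integral_inner_sampleError η hjk)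
  -- The number `(t + 1) * M` of summands is bounded by `n * M`, uniformly in the round.
  have h2 : ((Finset.univ.filter fun k : Fin n × Fin M => k.1.1 < t + 1).card : ℝ) ≤ n * M := by
    have := Finset.card_le_univ (Finset.univ.filter fun k : Fin n × Fin M => k.1.1 < t + 1)
    rw [Fintype.card_prod, Fintype.card_fin, Fintype.card_fin] at this
    exact_mod_cast this
  have h3 : ∀ ω, ‖gradError (n := n) K g η x₁ D t ω‖ ^ 2 = (1 / (M : ℝ)) ^ 2 *
      ‖∑ k : Fin n × Fin M with k.1.1 < t + 1, sampleError K g η x₁ D k ω‖ ^ 2 := fun ω => by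
    rw [gradError, norm_smul, mul_pow, Real.norm_of_nonneg (by positivity)]
  simp only [h3]
  rw [integral_const_mul, mul_pow, Real.sq_sqrt (by positivity)]
  calc _ ≤ (1 / (M : ℝ)) ^ 2 * (n * M * totalDev σ σL B ^ 2) := by
        gcongr
        exact h1.trans (mul_le_mul_of_nonneg_right h2 (sq_nonneg _))
    _ = totalDev σ σL B ^ 2 * (n / M) := by field_simp


lemma memLp_noise (k : Fin n × Fin M) :
    MemLp (fun ω : Datasets Z n × Noise d M n => ω.2 k.1 k.2) 2 (runLaw d n D s) :=
  (memLp_gaussian_smul d s).comp_measurePreserving (measurePreserving_noise k)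

lemma integral_inner_noise_eq_zero (k : Fin n × Fin M) {V : Datasets Z n × Noise d M n → Vec d}
    (hV : MemLp V 2 (runLaw d n D s)) (hVk : ∀ ω y, V (replaceNoise k (ω, y)) = V ω) :
    ∫ ω, inner ℝ (V ω) (ω.2 k.1 k.2) ∂(runLaw d n D s) = 0 := by
  refine integral_eq_zero_of_resample (measurePreserving_replaceNoise k)
    (integrable_inner_of_memLp hV (memLp_noise k)) fun ω => ?_
  have h : ∀ y, (replaceNoise k (ω, y)).2 k.1 k.2 = y := fun y => by simp [replaceNoise]
  simp only [hVk, h]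
  have hid : Integrable (fun y : Vec d => y) ((stdGaussian (Vec d)).map fun v => s • v) :=
    (memLp_gaussian_smul d s).integrable one_le_two
  rw [integral_inner hid, integral_gaussian_smul, inner_zero_right]

lemma memLp_avgNoise (t : Fin n) :
    MemLp (avgNoise (Z := Z) (M := M) (d := d) t) 2 (runLaw d n D s) :=
  (memLp_finsetSum Finset.univ fun i _ => memLp_noise (t, i)).const_smul (1 / (M : ℝ))

lemma integral_norm_sq_avgNoise_le (hM : 1 ≤ M) (t : Fin n) :
    ∫ ω, ‖avgNoise (Z := Z) (M := M) (d := d) t ω‖ ^ 2 ∂(runLaw d n D s) ≤ d * s ^ 2 / M := by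
  have hM0 : (0 : ℝ) < M := by exact_mod_cast hM
  have h1 := integral_norm_sq_sum_le (P := runLaw d n D s) (c := d * s ^ 2)
    (X := fun (i : Fin M) (ω : Datasets Z n × Noise d M n) => ω.2 t i) Finset.univ
    (fun i _ => memLp_noise (t, i))
    (fun i _ => by
      rw [← integral_norm_sq_gaussian_smul, ← (measurePreserving_noise (Z := Z) (D := D) (n := n)
        (s := s) (d := d) (t, i)).map_eq, integral_map
        (measurePreserving_noise (D := D) (s := s) (t, i)).measurable.aemeasurable (by fun_prop)])
    (fun i _ j _ hij => integral_inner_noise_eq_zero (t, j) (memLp_noise (t, i)) fun ω y => by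
      simp [replaceNoise, hij])
  have h3 : ∀ ω, ‖avgNoise (Z := Z) (M := M) (d := d) t ω‖ ^ 2 = (1 / (M : ℝ)) ^ 2 *
      ‖∑ i, ω.2 t i‖ ^ 2 := fun ω => by
    rw [avgNoise, norm_smul, mul_pow, Real.norm_of_nonneg (by positivity)]
  simp only [h3]
  rw [integral_const_mul]
  calc _ ≤ (1 / (M : ℝ)) ^ 2 * (M * (d * s ^ 2)) := by
        gcongr
        simpa using h1
    _ = d * s ^ 2 / M := by field_simp

lemma memLp_w_sub (H : IsProblem K x₁ f g D B G L σ σL) (η : ℝ) {t : ℕ} (ht : t ≤ n) {y : Vec d}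
    (hy : y ∈ K) : MemLp (fun ω : Datasets Z n × Noise d M n =>
      (stateAt K g η x₁ ω.1 ω.2 t ht).w - y) 2 (runLaw d n D s) :=
  MemLp.of_bound ((H.measurable_state η ht).1.sub_const y).aestronglyMeasurable B
    (ae_of_all _ fun ω => H.diam _ (H.stateAt_mem η ω ht).1 _ hy)

lemma integral_inner_avgNoise (H : IsProblem K x₁ f g D B G L σ σL) (η : ℝ) (t : Fin n)
    {y : Vec d} (hy : y ∈ K) :
    ∫ ω, inner ℝ (avgNoise t ω) ((stateAt K g η x₁ ω.1 ω.2 t t.2.le).w - y) ∂(runLaw d n D s)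
      = 0 := by
  have hV := H.memLp_w_sub (s := s) η t.2.le hy
  simp only [avgNoise, real_inner_smul_left, sum_inner]
  rw [integral_const_mul, integral_finsetSum _ fun i _ =>
    integrable_inner_of_memLp (memLp_noise (t, i)) hV, Finset.sum_eq_zero, mul_zero]
  intro i _
  rw [← integral_inner_noise_eq_zero (t, i) hV fun ω y' => by
    rw [stateAt_replaceNoise (t, i) ω y' t.2.le le_rfl]]
  exact integral_congr_ae (ae_of_all _ fun ω => real_inner_comm _ _)

lemma integrable_jointLoss_comp (H : IsProblem K x₁ f g D B G L σ σL) {Ω : Type*}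
    [MeasurableSpace Ω] {P : Measure Ω} [IsFiniteMeasure P] {x : Ω → Vec d} (hx : Measurable x)
    (hxK : ∀ ω, x ω ∈ K) : Integrable (fun ω => jointLoss f D (x ω)) P := by
  have hm : Measurable fun ω => jointLoss f D (x ω) :=
    measurable_comp_of_lipschitz (g := fun x (_ : Unit) => jointLoss f D x) H.G_nonneg
      (fun _ x hx y hy =>
        (Real.norm_eq_abs _).trans_le (abs_jointLoss_sub_le H.one_le H.smooth H.law hx hy))
      H.convex H.compact (fun _ => ()) (fun _ _ => measurable_const) x hx hxK
  refine Integrable.of_bound hm.aestronglyMeasurable (|jointLoss f D x₁| + G * B)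
    (ae_of_all _ fun ω => ?_)
  have h1 := abs_jointLoss_sub_le H.one_le H.smooth H.law (hxK ω) H.mem
  have h2 := mul_le_mul_of_nonneg_left (H.diam _ (hxK ω) _ H.mem) H.G_nonneg
  have h3 := abs_sub_abs_le_abs_sub (jointLoss f D (x ω)) (jointLoss f D x₁)
  rw [Real.norm_eq_abs]
  linarith

/-- The potential of the state before round `t + 1`, relative to the point `y`. -/
def potential (K : Set (Vec d)) (f : ∀ i, Vec d → Z i → ℝ) (g : ∀ i, Vec d → Z i → Vec d)
    (D : ∀ i, Measure (Z i)) (η : ℝ) (x₁ y : Vec d) (t : ℕ) (ht : t ≤ n)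
    (ω : Datasets Z n × Noise d M n) : ℝ :=
  impWeightSum (t + 1) *
      (jointLoss f D (stateAt K g η x₁ ω.1 ω.2 t ht).x - jointLoss f D y) +
    ‖(stateAt K g η x₁ ω.1 ω.2 t ht).w - y‖ ^ 2 / (2 * η)

lemma integrable_potential (H : IsProblem K x₁ f g D B G L σ σL) (η : ℝ) {y : Vec d} (hy : y ∈ K)
    {t : ℕ} (ht : t ≤ n) : Integrable (potential K f g D η x₁ y t ht) (runLaw d n D s) :=
  (((H.integrable_jointLoss_comp (H.measurable_state η ht).2.1
    fun ω => (H.stateAt_mem η ω ht).2.1).sub (integrable_const _)).const_mul _).add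
    (((H.memLp_w_sub η ht hy).integrable_norm_pow two_ne_zero).div_const _)

lemma integral_potential_le (H : IsProblem K x₁ f g D B G L σ σL) (hη : 0 < η) {y : Vec d}
    (hy : y ∈ K) {t : ℕ} (ht : t ≤ n) :
    ∫ ω, potential K f g D η x₁ y t ht ω ∂(runLaw d n D s) ≤
      G * B + B ^ 2 / (2 * η) + t * (G * B + 2 * L * B ^ 2 +
        (B * (totalDev σ σL B * √(n / M)) + η / 2 * (d * s ^ 2 / M))) := by
  have hB := H.B_nonneg
  induction t with
  | zero =>
      have h1 : ∀ ω : Datasets Z n × Noise d M n,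
          potential K f g D η x₁ y 0 ht ω ≤ G * B + B ^ 2 / (2 * η) := fun ω => by
        have h2 := H.diam _ H.mem _ hy
        have h3 := (le_abs_self _).trans (abs_jointLoss_sub_le H.one_le H.smooth H.law H.mem hy)
        have h4 := mul_le_mul_of_nonneg_left h2 H.G_nonneg
        have h5 : impWeightSum (0 + 1) = 1 := by rw [impWeightSum_eq]; norm_num
        simp only [potential, stateAt_zero, initState, h5, one_mul]
        gcongr
        linarith
      refine (integral_mono (H.integrable_potential η hy ht) (integrable_const _) h1).trans ?_
      simp
  | succ t ih =>
      have ih := ih (by omega)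
      have htn : t < n := ht
      have hstep : ∀ ω : Datasets Z n × Noise d M n, potential K f g D η x₁ y (t + 1) ht ω ≤
          potential K f g D η x₁ y t htn.le ω + (G * B + 2 * L * B ^ 2) +
          (B * ‖gradError K g η x₁ D t ω‖ -
            inner ℝ (avgNoise ⟨t, htn⟩ ω) ((stateAt K g η x₁ ω.1 ω.2 t htn.le).w - y) +
            η / 2 * ‖avgNoise ⟨t, htn⟩ ω‖ ^ 2) := fun ω => by
        refine round_progress H.convex H.compact H.L_nonneg hη H.diam
          (fun x hx y hy => inner_jointGrad_le H.smooth H.law H.convex H.G_nonneg hx hy)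
          (fun x hx => norm_jointGrad_le (D := D) H.one_le H.smooth H.convex H.G_nonneg hx)
          (fun x hx y hy => norm_jointGrad_sub_le H.one_le H.smooth H.law H.convex H.G_nonneg hx hy)
          t (H.stateAt_mem η ω htn.le).2.1 (H.stateAt_mem η ω ht).2.1 hy ?_
          (stateAt_succ_x _ _ _ _)
        rw [stateAt_succ_w, average_msg (D := D)]
      have i0 := H.integrable_potential (s := s) η hy htn.le
      have i1 : Integrable (fun ω => ‖gradError (n := n) K g η x₁ D t ω‖) (runLaw d n D s) :=
        ((H.memLp_gradError η t).integrable one_le_two).norm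
      have i2 : Integrable (fun ω : Datasets Z n × Noise d M n =>
          inner ℝ (avgNoise ⟨t, htn⟩ ω) ((stateAt K g η x₁ ω.1 ω.2 t htn.le).w - y))
          (runLaw d n D s) :=
        integrable_inner_of_memLp (memLp_avgNoise _) (H.memLp_w_sub η _ hy)
      have i3 : Integrable (fun ω => ‖avgNoise (Z := Z) (M := M) (d := d) ⟨t, htn⟩ ω‖ ^ 2)
          (runLaw d n D s) := (memLp_avgNoise _).integrable_norm_pow two_ne_zero
      have e1 := H.integral_norm_gradError_le (n := n) (s := s) η t
      have e2 := H.integral_inner_avgNoise (s := s) η ⟨t, htn⟩ hy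
      have e3 := integral_norm_sq_avgNoise_le (Z := Z) (D := D) (d := d) (s := s) H.one_le ⟨t, htn⟩
      have j1 : Integrable (fun ω => potential K f g D η x₁ y t htn.le ω + (G * B + 2 * L * B ^ 2))
          (runLaw d n D s) := i0.add (integrable_const _)
      have j2 : Integrable (fun ω : Datasets Z n × Noise d M n => B * ‖gradError K g η x₁ D t ω‖ -
          inner ℝ (avgNoise ⟨t, htn⟩ ω) ((stateAt K g η x₁ ω.1 ω.2 t htn.le).w - y))
          (runLaw d n D s) := (i1.const_mul B).sub i2
      have j3 := i3.const_mul (η / 2)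
      refine (integral_mono (H.integrable_potential η hy ht) (j1.add (j2.add j3)) hstep).trans ?_
      rw [integral_add' j1 (j2.add j3), integral_add' j2 j3, integral_sub (i1.const_mul B) i2,
        integral_add i0 (integrable_const _), integral_const_mul, integral_const_mul, e2]
      simp only [integral_const, probReal_univ, one_smul, sub_zero]
      have := mul_le_mul_of_nonneg_left e1 hB
      have := mul_le_mul_of_nonneg_left e3 (half_pos hη).le
      push_cast
      linarith

end IsProblem


/-! ### The excess loss with the chosen noise level and learning rate -/

section Bounds

variable {d M n : ℕ} {Z : Fin M → Type*} [∀ i, MeasurableSpace (Z i)] {K : Set (Vec d)}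
  {x₁ : Vec d} {f : ∀ i, Vec d → Z i → ℝ} {g : ∀ i, Vec d → Z i → Vec d}
  {D : ∀ i, Measure (Z i)} [∀ i, IsProbabilityMeasure (D i)] {B G L σ σL ε δ : ℝ}

lemma IsProblem.integrable_loss (H : IsProblem K x₁ f g D B G L σ σL) (η s : ℝ) :
    Integrable (fun ω : Datasets Z n × Noise d M n =>
      jointLoss f D (output K g η x₁ ω.1 ω.2)) (runLaw d n D s) :=
  H.integrable_jointLoss_comp (H.measurable_state η le_rfl).2.2
    fun ω => (H.stateAt_mem η ω le_rfl).2.2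

lemma IsProblem.integral_loss_sub_le (H : IsProblem K x₁ f g D B G L σ σL) (hn : 1 ≤ n)
    (hB : 0 < B) (hG : 0 < G) (hL : 0 < L) (hε : 0 < ε) (hδ : 0 < δ) (hδ1 : δ < 1)
    {y : Vec d} (hy : y ∈ K) :
    ∫ ω, jointLoss f D (output K g (learningRate G L B ε δ d M n) x₁ ω.1 ω.2)
        ∂(runLaw d n D (noiseStd G L B ε δ n)) - jointLoss f D y ≤
      4 * B * (sens G L B / n + totalDev σ σL B / √(n * M) +
        sens G L B * √d / (budget ε δ * n * √M)) := by
  have hM := H.M_pos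
  have hρ := budget_pos hε hδ hδ1
  have hS : 0 < sens G L B := by unfold sens; positivity
  have hτ := H.totalDev_nonneg
  have hn0 : (0 : ℝ) < n := by exact_mod_cast hn
  -- For `d = 0` the learning rate is a division by zero and not positive, but the space is a single
  -- point.
  rcases Nat.eq_zero_or_pos d with rfl | hd
  · have h : ∀ x : Vec 0, jointLoss f D x = jointLoss f D y := fun x => by
      rw [Subsingleton.elim x y]
    simp only [h, integral_const, probReal_univ, one_smul, sub_self]
    positivity
  have hd0 : (0 : ℝ) < d := by exact_mod_cast hd
  set η := learningRate G L B ε δ d M n with hη_def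
  set s := noiseStd G L B ε δ n with hs_def
  have hη : 0 < η := by rw [hη_def, learningRate]; positivity
  -- The output is the query point of the last round, so only the first `n - 1` steps of the server
  -- count.
  obtain ⟨m, rfl⟩ : ∃ m, n = m + 1 := ⟨n - 1, by omega⟩
  set N : ℝ := ((m + 1 : ℕ) : ℝ) with hN
  have hNm : N = m + 1 := by rw [hN]; push_cast; ring
  set R := sens G L B * √d / (budget ε δ * √M) with hR
  have hR0 : 0 ≤ R := by positivity
  have key := H.integral_potential_le (n := m + 1) (s := s) hη hy (Nat.le_succ m)
  have e1 : B ^ 2 / (2 * η) = B * N * R := by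
    rw [hη_def, learningRate, hR, ← hN]
    field_simp
  have e2 : η / 2 * (d * s ^ 2 / M) = B * R := by
    have hsd := Real.sq_sqrt hd0.le
    have hsM := Real.sq_sqrt hM.le
    have hsN := Real.sq_sqrt hn0.le
    have : η / 2 * (d * s ^ 2 / M) = B * sens G L B * √N ^ 2 / N * d * √M /
        (budget ε δ * M * √d) := by
      rw [hη_def, hs_def, learningRate, noiseStd]
      field_simp
      ring
    rw [this, hsN, hR]
    nth_rewrite 1 [← hsd]
    nth_rewrite 2 [← hsM]
    field_simp
  rw [e1, e2] at key
  have hint := H.integrable_loss (n := m + 1) η s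
  have hlow : N * (N + 1) / 2 * (∫ ω, jointLoss f D (output K g η x₁ ω.1 ω.2)
      ∂(runLaw d (m + 1) D s) - jointLoss f D y) ≤
      ∫ ω, IsProblem.potential K f g D η x₁ y m (Nat.le_succ m) ω ∂(runLaw d (m + 1) D s) := by
    have h1 : N * (N + 1) / 2 * (∫ ω, jointLoss f D (output K g η x₁ ω.1 ω.2)
        ∂(runLaw d (m + 1) D s) - jointLoss f D y) =
        ∫ ω, N * (N + 1) / 2 * (jointLoss f D (output K g η x₁ ω.1 ω.2) - jointLoss f D y)
          ∂(runLaw d (m + 1) D s) := by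
      rw [integral_const_mul, integral_sub hint (integrable_const _)]
      simp
    rw [h1]
    refine integral_mono ((hint.sub (integrable_const _)).const_mul _)
      (H.integrable_potential η hy _) fun ω => ?_
    have h2 : 0 ≤ ‖(stateAt K g η x₁ ω.1 ω.2 m (Nat.le_succ m)).w - y‖ ^ 2 / (2 * η) := by
      positivity
    have h3 : output K g η x₁ ω.1 ω.2 = (stateAt K g η x₁ ω.1 ω.2 m (Nat.le_succ m)).x := rfl
    rw [h3, IsProblem.potential, impWeightSum_eq, ← hN]
    linarith
  set X := ∫ ω, jointLoss f D (output K g η x₁ ω.1 ω.2) ∂(runLaw d (m + 1) D s) - jointLoss f D y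
  set q := √(N / M) with hq
  have hq0 : 0 ≤ q := Real.sqrt_nonneg _
  have hm0 : (0 : ℝ) ≤ m := Nat.cast_nonneg m
  -- One `R` comes from the initial distance and one from the noise. The remaining slack is the cost
  -- of one extra round, which raises the factor `m` to `N`.
  have hup : N * (N + 1) / 2 * X ≤ N * B * (sens G L B + totalDev σ σL B * q + 2 * R) := by
    have h1 : 0 ≤ 2 * L * B ^ 2 + B * (totalDev σ σL B * q) + B * R := by positivity
    have h2 : N * B * (sens G L B + totalDev σ σL B * q + 2 * R) =
        G * B + B * N * R + m * (G * B + 2 * L * B ^ 2 + (B * (totalDev σ σL B * q) + B * R)) +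
        (2 * L * B ^ 2 + B * (totalDev σ σL B * q) + B * R) := by
      rw [hNm, sens]; ring
    linarith
  have e3 : 4 * B * (sens G L B / N + totalDev σ σL B / √(N * M) +
      sens G L B * √d / (budget ε δ * N * √M)) =
      4 * B * (sens G L B + totalDev σ σL B * q + R) / N := by
    have h1 : 1 / √(N * M) = q / N := by
      rw [hq, Real.sqrt_div hn0.le, Real.sqrt_mul hn0.le]
      nth_rewrite 3 [← Real.sq_sqrt hn0.le]
      field_simp
    have h2 : totalDev σ σL B / √(N * M) = totalDev σ σL B * q / N := by
      rw [div_eq_mul_one_div, h1, mul_div_assoc]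
    rw [h2, hR]
    field_simp
  rw [e3, le_div_iff₀ hn0]
  -- Replacing `N + 1` by `N` needs `X` nonnegative, which is not known in advance: `output` need
  -- not lie above an arbitrary `y`. If the claim fails, then `X > 0`.
  by_contra! hlt
  have hX : 0 < X := by
    have : 0 ≤ 4 * B * (sens G L B + totalDev σ σL B * q + R) := by positivity
    exact pos_of_mul_pos_left (this.trans_lt hlt) hn0.le
  have h4 : N * (X * N) ≤ N * (4 * B * (sens G L B + totalDev σ σL B * q + R)) := by
    have h5 : 0 ≤ N * X := by positivity
    have h6 : 0 ≤ N * B * (sens G L B + totalDev σ σL B * q) := by positivity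
    linarith
  exact absurd (le_of_mul_le_mul_left h4 hn0) (not_le.2 hlt)

lemma excess_bound_le (hM : 1 ≤ M) (hn : 1 ≤ n) (hB : 0 < B) {S τ : ℝ} (hS : 0 ≤ S) (hτ : 0 ≤ τ)
    (hε : 0 < ε) (hδ : 0 < δ) (hδ1 : δ < 1)
    (h : M ≤ n ∨ ε ^ 2 * M ≤ d * (ε + Real.log (1 / δ))) :
    4 * B * (S / n + τ / √(n * M) + S * √d / (budget ε δ * n * √M)) ≤
      10 * B * (S + τ) * (1 / √(n * M) + √(d * (ε + Real.log (1 / δ))) / (ε * n * √M)) := by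
  have hM0 : (0 : ℝ) < M := by exact_mod_cast hM
  have hn0 : (0 : ℝ) < n := by exact_mod_cast hn
  have hρ := budget_pos hε hδ hδ1
  set l := Real.log (1 / δ) with hl_def
  have hl : 0 < l := Real.log_pos (by rw [lt_div_iff₀ hδ]; linarith)
  set u := 1 / √(n * M) with hu
  set v := √(d * (ε + l)) / (ε * n * √M) with hv
  have hu0 : 0 ≤ u := by positivity
  have hv0 : 0 ≤ v := by positivity
  -- The case assumption serves only to absorb the noise-free term `S / n` into one of the two
  -- rates.
  have h1 : 1 / (n : ℝ) ≤ u ∨ 1 / (n : ℝ) ≤ v := by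
    refine h.imp (fun h => ?_) (fun h => ?_)
    · refine one_div_le_one_div_of_le (by positivity) (Real.sqrt_le_iff.2 ⟨hn0.le, ?_⟩)
      have : (M : ℝ) ≤ n := by exact_mod_cast h
      nlinarith
    · have h2 : ε * √M ≤ √(d * (ε + l)) := by
        refine Real.le_sqrt_of_sq_le ?_
        rw [mul_pow, Real.sq_sqrt hM0.le]
        exact h
      rw [hv, div_le_div_iff₀ hn0 (by positivity)]
      nlinarith
  have h2 : √d / (budget ε δ * n * √M) ≤ 3 / 2 * v := by
    -- By the equation for `ρ`, `ε ≤ ρ (ρ + √(2l)) = ρ √(2 (ε + l))`, and `√2 ≤ 3 / 2`. The final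
    -- constant is `4 (1 + 3 / 2) = 10`.
    have h3 : ε ≤ budget ε δ * (3 / 2 * √(ε + l)) := by
      have h4 := budget_eq hε hδ hδ1
      rw [← hl_def] at h4
      have h5 : √(2 * (ε + l)) = budget ε δ + √(2 * l) := by rw [budget, ← hl_def]; ring
      have h6 : √(2 * (ε + l)) ≤ 3 / 2 * √(ε + l) := by
        rw [Real.sqrt_mul zero_le_two]
        refine mul_le_mul_of_nonneg_right ?_ (Real.sqrt_nonneg _)
        rw [Real.sqrt_le_iff]
        norm_num
      have h7 := mul_le_mul_of_nonneg_left h6 hρ.le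
      rw [h5] at h7
      nlinarith [sq_nonneg (budget ε δ)]
    rw [hv, Real.sqrt_mul (Nat.cast_nonneg d), mul_div_assoc', div_le_div_iff₀ (by positivity)
      (by positivity)]
    calc √d * (ε * n * √M) = ε * (√d * n * √M) := by ring
      _ ≤ budget ε δ * (3 / 2 * √(ε + l)) * (√d * n * √M) := by gcongr
      _ = 3 / 2 * (√d * √(ε + l)) * (budget ε δ * n * √M) := by ring
  have h3 : S / n + τ / √(n * M) + S * √d / (budget ε δ * n * √M) =
      S * (1 / n) + τ * u + S * (√d / (budget ε δ * n * √M)) := by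
    rw [hu]; ring
  have h4 := mul_le_mul_of_nonneg_left h2 hS
  have h5 : S * (1 / n) ≤ S * (u + v) :=
    mul_le_mul_of_nonneg_left (h1.elim (fun h => by linarith) fun h => by linarith) hS
  have h6 : 0 ≤ τ * v := mul_nonneg hτ hv0
  have h7 : 0 ≤ τ * u := mul_nonneg hτ hu0
  have h8 : 0 ≤ S * u := mul_nonneg hS hu0
  have h9 : 0 ≤ S * v := mul_nonneg hS hv0
  have h10 : 4 * (S * (1 / n) + τ * u + S * (√d / (budget ε δ * n * √M))) ≤
      10 * ((S + τ) * (u + v)) := by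
    linarith
  rw [h3]
  linarith [mul_le_mul_of_nonneg_left h10 hB.le]

end Bounds

end FedDP

end

theorem mainTheorem1 {d M n : ℕ} (hM : 1 ≤ M) (hn : 1 ≤ n) {Z : Fin M → Type*}
    [∀ i, MeasurableSpace (Z i)] (K : Set (FedDP.Vec d)) (hKconv : Convex ℝ K)
    (hKcomp : IsCompact K) (B G L : ℝ) (hB : 0 < B) (hG : 0 < G) (hL : 0 < L)
    (hdiam : ∀ x ∈ K, ∀ y ∈ K, ‖x - y‖ ≤ B) (x₁ : FedDP.Vec d) (hx₁ : x₁ ∈ K)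
    (f : ∀ i, FedDP.Vec d → Z i → ℝ) (g : ∀ i, FedDP.Vec d → Z i → FedDP.Vec d)
    (hf : ∀ i, FedDP.IsSmoothLoss K (f i) (g i) G L)
    (ε δ : ℝ) (hε : 0 < ε) (hδ : 0 < δ) (hδ1 : δ < 1) :
    -- privacy of every machine, for every learning rate
    (∀ (η : ℝ) (i : Fin M),
      FedDP.IsDP (FedDP.NeighboursAt i)
        (FedDP.noiseLaw d M n (FedDP.noiseStd G L B ε δ n))
        (FedDP.transcript (n := n) K g η x₁) ε δ) ∧
    -- computational cost, linear in the number `n * M` of samples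
    (∀ (η : ℝ) (S : FedDP.Datasets Z n) (Y : FedDP.Noise d M n),
      (FedDP.fullRun K g η x₁ S Y).grads = 2 * (n * M) ∧
      (FedDP.fullRun K g η x₁ S Y).ops ≤ 14 * (n * M)) ∧
    -- excess loss, for arbitrary distributions of the machines
    (∀ (σ σL : ℝ), 0 ≤ σ → 0 ≤ σL →
      ∀ (D : ∀ i, Measure (Z i)) [∀ i, IsProbabilityMeasure (D i)],
      (∀ i, FedDP.IsSampleLaw K (f i) (g i) σ σL (D i)) →
      let P := (FedDP.dataLaw n D).prod
        (FedDP.noiseLaw d M n (FedDP.noiseStd G L B ε δ n))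
      let loss := fun ω : FedDP.Datasets Z n × FedDP.Noise d M n =>
        FedDP.jointLoss f D
          (FedDP.output K g (FedDP.learningRate G L B ε δ d M n) x₁ ω.1 ω.2)
      let excess := (∫ ω, loss ω ∂P) - sInf (FedDP.jointLoss f D '' K)
      Integrable loss P ∧
      excess ≤ 4 * B * (FedDP.sens G L B / n + FedDP.totalDev σ σL B / √(n * M)
        + FedDP.sens G L B * √d / (FedDP.budget ε δ * n * √M)) ∧
      ((M ≤ n ∨ ε ^ 2 * M ≤ d * (ε + Real.log (1 / δ))) →
        excess ≤ 10 * B * (FedDP.sens G L B + FedDP.totalDev σ σL B) *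
          (1 / √(n * M) + √(d * (ε + Real.log (1 / δ))) / (ε * n * √M)))) := by
  refine ⟨fun η i => FedDP.isDP_transcript hn hKconv hKcomp hB hG hL hdiam hx₁ hf hε hδ hδ1 η i,
    fun η S Y => ⟨FedDP.grads_fullRun S Y, ?_⟩, fun σ σL hσ hσL D _ hD => ?_⟩
  · rw [FedDP.ops_fullRun]
    nlinarith
  have H : FedDP.IsProblem K x₁ f g D B G L σ σL :=
    ⟨hM, hKconv, hKcomp, hx₁, hdiam, hG.le, hL.le, hσ, hσL, hf, hD⟩
  have hbound : (∫ ω, FedDP.jointLoss f D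
        (FedDP.output K g (FedDP.learningRate G L B ε δ d M n) x₁ ω.1 ω.2)
        ∂(FedDP.runLaw d n D (FedDP.noiseStd G L B ε δ n))) - sInf (FedDP.jointLoss f D '' K) ≤
      4 * B * (FedDP.sens G L B / n + FedDP.totalDev σ σL B / √(n * M)
        + FedDP.sens G L B * √d / (FedDP.budget ε δ * n * √M)) := by
    rw [sub_le_comm]
    -- The bound holds against every fixed comparison point `y`, hence against the infimum; no
    -- minimizer is chosen.
    refine le_csInf ⟨_, x₁, hx₁, rfl⟩ ?_
    rintro _ ⟨y, hy, rfl⟩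
    rw [sub_le_comm]
    exact H.integral_loss_sub_le hn hB hG hL hε hδ hδ1 hy
  refine ⟨H.integrable_loss _ _, hbound, fun h => hbound.trans ?_⟩
  refine FedDP.excess_bound_le hM hn hB ?_ H.totalDev_nonneg hε hδ hδ1 h
  unfold FedDP.sens
  positivity
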